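/- Let $0<\epsilon<1$ and $R>0$. Messages of $k$ independent fair bits are encoded into codewords of $n$ bits, which are sent through $n$ uses of the binary erasure channel with erasure probability $\epsilon$; the block error probability is the probability that the decoding function does not return the message. An encoding scheme is a sequence of codes of block lengths $n_1<n_2<\cdots$ with $k(n)$ message bits, given by encoder circuits and decoding functions; we assume that $k(n)/n\to R$, i.e. that the asymptotic rate is positive. For $f$ with $f(n)\le 1$ for all large $n$, it is an $f(n)$-encoding scheme if the block error probability is less than $f(n)$ for all sufficiently large block lengths $n$. All bounds below are for block length tending to infinity, and the sign of the logarithm is dropped in the usual way: $|\log f(n)|=-\log f(n)\ge 0$. Thompson model: a circuit consists of nodes with a constant number $m$ of bits of memory, the same for the whole scheme, and of wires, laid out on a planar grid of unit squares; in each clock cycle a node receives and sends one bit on each of its wires and may take in one input bit and produce one output bit, every input bit being injected once and every output bit being produced once, at fixed nodes and in fixed cycles. Let $A(n)$ be the area (the number of squares occupied) of the encoder of block length $n$, $T(n)$ its number of clock cycles, and $E(n)=A(n)T(n)$ its energy. A circuit is fully parallel if every input bit and every output bit has a node of its own, and output regular if in each clock cycle either all output nodes produce a bit or none does; a scheme is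 serial if the number $j$ of output nodes is constant. 1. Every fully-parallel $f(n)$-encoding scheme satisfies $$E(n)\ge\Omega\left(\frac{n\,|\log f(n)|}{T(n)}\right)\qquad\text{and}\qquad E(n)\ge\Omega\left(n\sqrt{|\log f(n)|}\right),$$ and if the second bound is attained, i.e. $E(n)=O\left(n\sqrt{|\log f(n)|}\right)$, then $T(n)\ge\Omega\left(\sqrt{|\log f(n)|}\right)$. 2. Every serial $f(n)$-encoding scheme satisfies $E(n)\ge\Omega\left(n\,|\log f(n)|\right)$. 3. Every output-regular $f(n)$-encoding scheme, in particular every one whose number of output nodes increases with the block length, satisfies $E(n)\ge\Omega\left(n\,|\log f(n)|^{1/5}\right)$. 4. Three-dimensional bit-meters model: nodes are points of $\mathbb{Z}^3$, every input bit and every output bit has a node of its own, every communicated bit is a function of what its sender has received, and the energy is the sum of the Euclidean distances over which the bits are communicated. Every sequence of bit-meters encoders with block error probabilities $P_{\mathrm e}(n)$ that are eventually at most some $\delta<1$ (in particular if $P_{\mathrm e}(n)\to 0$) satisfies $$E(n)\ge\Omega\left(n\,|\log P_{\mathrm e}(n)|^{1/3}\right).$$ The implied constants depend only on $\epsilon$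 and $R$ and, in addition, in the last claim of 1 on the constant in $O(\cdot)$, in 2 on $m$ and $j$, in 3 on $m$, in 4 on $\delta$. -/

import Mathlib

open Filter Topology

noncomputable section

/-! ## Coding over the binary erasure channel -/

/-- The word received when `y` is sent and exactly the positions in `E` are erased
(an erased symbol is `none`). -/
def erase {n : ℕ} (E : Finset (Fin n)) (y : Fin n → Bool) : Fin n → Option Bool :=
  fun j => if j ∈ E then none else some (y j)

open Classical in
/-- Block error probability of the encoding function `enc` with the decoding function `dec`, when
the message consists of `k` independent fair bits and the codeword is sent through `n` uses of the
binary erasure channel with erasure probability `ε`. -/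
def blockErrorProb (ε : ℝ) {k n : ℕ} (enc : (Fin k → Bool) → (Fin n → Bool))
    (dec : (Fin n → Option Bool) → (Fin k → Bool)) : ℝ :=
  ∑ x : Fin k → Bool, (1 / 2 : ℝ) ^ k *
    ∑ E : Finset (Fin n), ε ^ E.card * (1 - ε) ^ (n - E.card) *
      (if dec (erase E (enc x)) = x then 0 else 1)

/-! ## Circuits in the Thompson model -/

/-- The grid of unit squares of the plane; two squares are adjacent when they share a side. -/
def gridGraph : SimpleGraph (ℤ × ℤ) where
  Adj p q := |p.1 - q.1| + |p.2 - q.2| = 1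
  symm := ⟨fun p q h => by rw [abs_sub_comm q.1, abs_sub_comm q.2]; exact h⟩
  loopless := ⟨fun p h => by simp at h⟩

/-- A layout on the grid: nodes occupy one unit square each, and every wire runs along a path of
squares between two different nodes, passing through no other node. At most one wire passes through
any side of a square, so that a square carries a node, a single wire, or two wires that meet
there (for example by crossing), and a node has at most four wires. -/
structure Layout where
  nodes : Finset (ℤ × ℤ)
  numWires : ℕ
  src : Fin numWires → ℤ × ℤ
  dst : Fin numWires → ℤ × ℤ
  src_mem : ∀ w, src w ∈ nodes
  dst_mem : ∀ w, dst w ∈ nodes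
  src_ne_dst : ∀ w, src w ≠ dst w
  route : ∀ w, gridGraph.Walk (src w) (dst w)
  route_isPath : ∀ w, (route w).IsPath
  route_avoids : ∀ w, ∀ p ∈ (route w).support, p ∈ nodes → p = src w ∨ p = dst w
  route_disjoint : ∀ w w', w ≠ w' → ∀ e ∈ (route w).edges, e ∉ (route w').edges

/-- The area: the number of unit squares occupied by a node or a wire. -/
def Layout.area (Λ : Layout) : ℕ :=
  (Λ.nodes ∪ Finset.univ.biUnion fun w => (Λ.route w).support.toFinset).card

/-- A circuit with `k` input bits and `n` output bits whose nodes have `m` bits of memory each,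
running for `T` clock cycles.

Input bit `i` is injected once, into the node `(inPort i).1` in cycle `(inPort i).2`; a node gets at
most one input bit per cycle. Output bit `i` is produced at the node `(outPort i).1` in
cycle `(outPort i).2`; a node produces at most one output bit per cycle.

In every cycle `t` a node `v` computes, from its memory, the bits that arrive on its wires and its
input bit in this cycle (if there is one), the value `step t v` that consists of its new memory,
the bits that it sends on its wires and the bit that it outputs. -/
structure Circuit (m k n : ℕ) extends Layout where
  T : ℕ
  inPort : Fin k → (ℤ × ℤ) × Fin T
  inPort_mem : ∀ i, (inPort i).1 ∈ nodes
  inPort_injective : Function.Injective inPort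
  outPort : Fin n → (ℤ × ℤ) × Fin T
  outPort_mem : ∀ i, (outPort i).1 ∈ nodes
  outPort_injective : Function.Injective outPort
  init : ℤ × ℤ → (Fin m → Bool)
  step : Fin T → ℤ × ℤ → (Fin m → Bool) → (Fin numWires → Bool) → Option Bool →
    (Fin m → Bool) × (Fin numWires → Bool) × Bool

namespace Circuit

variable {m k n : ℕ} (C : Circuit m k n)

/-- What is stored between two clock cycles: the memory of the nodes, and for every wire the bit in
transit from its `src` to its `dst` and the bit in transit the other way. -/
structure Config (m k n : ℕ) (C : Circuit m k n) where
  mem : ℤ × ℤ → (Fin m → Bool)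
  fwd : Fin C.numWires → Bool
  bwd : Fin C.numWires → Bool

/-- The bits that arrive at `v`; a wire that does not end at `v` shows `false`. -/
def arriving (c : Config m k n C) (v : ℤ × ℤ) : Fin C.numWires → Bool :=
  fun w => if C.dst w = v then c.fwd w else if C.src w = v then c.bwd w else false

open Classical in
/-- The input bit that is injected into `v` in cycle `t`, if there is one. -/
def inputAt (x : Fin k → Bool) (v : ℤ × ℤ) (t : Fin C.T) : Option Bool :=
  if h : ∃ i, C.inPort i = (v, t) then some (x h.choose) else none

/-- Everything that node `v` computes in cycle `t`. -/
def nodeResult (x : Fin k → Bool) (c : Config m k n C) (t : Fin C.T) (v : ℤ × ℤ) :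
    (Fin m → Bool) × (Fin C.numWires → Bool) × Bool :=
  C.step t v (c.mem v) (C.arriving c v) (C.inputAt x v t)

/-- One clock cycle of the whole circuit. -/
def next (x : Fin k → Bool) (c : Config m k n C) (t : Fin C.T) : Config m k n C where
  mem v := (C.nodeResult x c t v).1
  fwd w := (C.nodeResult x c t (C.src w)).2.1 w
  bwd w := (C.nodeResult x c t (C.dst w)).2.1 w

/-- The configuration before cycle `t` (constant from the end of the computation on). -/
def configAt (x : Fin k → Bool) : ℕ → Config m k n C
  | 0 => ⟨C.init, fun _ => false, fun _ => false⟩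
  | t + 1 => if h : t < C.T then C.next x (configAt x t) ⟨t, h⟩ else configAt x t

/-- The function computed by the circuit. -/
def compute (x : Fin k → Bool) : Fin n → Bool :=
  fun i => (C.nodeResult x (C.configAt x (C.outPort i).2) (C.outPort i).2 (C.outPort i).1).2.2

/-- The Thompson energy: area times number of clock cycles. -/
def energy : ℕ := C.area * C.T

/-- Every input bit has an input node of its own and every output bit has an output node of its
own. -/
def FullyParallel : Prop :=
  (Function.Injective fun i => (C.inPort i).1) ∧ (Function.Injective fun i => (C.outPort i).1)

/-- The output nodes. -/
def outputNodes : Finset (ℤ × ℤ) := Finset.univ.image fun i => (C.outPort i).1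

/-- In every clock cycle either each output node outputs a bit or none does. -/
def OutputRegular : Prop :=
  ∀ t : Fin C.T, (∃ i, (C.outPort i).2 = t) → ∀ v ∈ C.outputNodes, ∃ i, C.outPort i = (v, t)

end Circuit

/-- An encoding scheme: a sequence of codes of increasing block lengths `n i`, with `k i` message
bits, given by encoder circuits together with decoding functions. All nodes of all the circuits have
the same constant amount `m` of memory. -/
structure EncodingScheme (m : ℕ) where
  n : ℕ → ℕ
  n_strictMono : StrictMono n
  k : ℕ → ℕ
  encoder : ∀ i, Circuit m (k i) (n i)
  decoder : ∀ i, (Fin (n i) → Option Bool) → (Fin (k i) → Bool)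

namespace EncodingScheme

variable {m : ℕ} (S : EncodingScheme m)

/-- The asymptotic rate is `R`. -/
def HasRate (R : ℝ) : Prop := Tendsto (fun i => (S.k i : ℝ) / S.n i) atTop (𝓝 R)

/-- The scheme is an `f(n)`-encoding scheme for the erasure channel with erasure probability `ε`:
for all sufficiently large block lengths `n` the block error probability is less than `f n`. -/
def IsEncodingSchemeFor (ε : ℝ) (f : ℕ → ℝ) : Prop :=
  ∀ᶠ i in atTop, blockErrorProb ε (S.encoder i).compute (S.decoder i) < f (S.n i)

/-- Energy of the `i`-th encoder. -/
def E (i : ℕ) : ℝ := (S.encoder i).energy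

/-- Number of clock cycles of the `i`-th encoder. -/
def T (i : ℕ) : ℝ := (S.encoder i).T

def FullyParallel : Prop := ∀ i, (S.encoder i).FullyParallel

/-- All encoders have the same number `j` of output nodes. -/
def Serial (j : ℕ) : Prop := ∀ i, (S.encoder i).outputNodes.card = j

def OutputRegular : Prop := ∀ i, (S.encoder i).OutputRegular

end EncodingScheme

/-! ## Three-dimensional bit-meters circuits -/

/-- A bit-meters circuit on the grid `ℤ³` with `k` input bits and `n` output bits, each with a node
of its own (a node may be both an input node and an output node).

One bit is communicated at a time: message `e` goes from node `src e` to node `dst e`, and these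
pairs are the edges of the communication multigraph. The bit `msg e` may be any function of the
input bit of `src e` and of the bits that `src e` has received before; likewise `out j` at the end
of the computation. -/
structure BitMetersCircuit (k n : ℕ) where
  inNode : Fin k → (Fin 3 → ℤ)
  inNode_injective : Function.Injective inNode
  outNode : Fin n → (Fin 3 → ℤ)
  outNode_injective : Function.Injective outNode
  numMsgs : ℕ
  src : Fin numMsgs → (Fin 3 → ℤ)
  dst : Fin numMsgs → (Fin 3 → ℤ)
  msg : Fin numMsgs → (Fin k → Bool) → (Fin numMsgs → Bool) → Bool
  out : Fin n → (Fin k → Bool) → (Fin numMsgs → Bool) → Bool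

namespace BitMetersCircuit

variable {k n : ℕ} (C : BitMetersCircuit k n)

/-- The input bits as node `v` sees them: those of other nodes are replaced by `false`. -/
def ownInputs (x : Fin k → Bool) (v : Fin 3 → ℤ) : Fin k → Bool :=
  fun i => if C.inNode i = v then x i else false

/-- The communicated bits as node `v` sees them: those sent to other nodes are replaced by
`false`. -/
def received (b : Fin C.numMsgs → Bool) (v : Fin 3 → ℤ) : Fin C.numMsgs → Bool :=
  fun e => if C.dst e = v then b e else false

/-- The bits of the first `t` messages (and `false` for the messages not yet sent). -/
def bitsAt (x : Fin k → Bool) : ℕ → (Fin C.numMsgs → Bool)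
  | 0 => fun _ => false
  | t + 1 => fun e =>
      if (e : ℕ) = t then
        C.msg e (C.ownInputs x (C.src e)) (C.received (bitsAt x t) (C.src e))
      else bitsAt x t e

/-- The function computed by the circuit. -/
def compute (x : Fin k → Bool) : Fin n → Bool :=
  fun j => C.out j (C.ownInputs x (C.outNode j))
    (C.received (C.bitsAt x C.numMsgs) (C.outNode j))

/-- The bit-meters: the sum over all communicated bits of the Euclidean distance travelled. -/
def bitMeters : ℝ :=
  ∑ e, Real.sqrt (∑ a, ((C.src e a : ℝ) - (C.dst e a : ℝ)) ^ 2)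

end BitMetersCircuit

/-- A sequence of codes of increasing block lengths, given by bit-meters encoder circuits together
with decoding functions. -/
structure BitMetersEncodingScheme where
  n : ℕ → ℕ
  n_strictMono : StrictMono n
  k : ℕ → ℕ
  encoder : ∀ i, BitMetersCircuit (k i) (n i)
  decoder : ∀ i, (Fin (n i) → Option Bool) → (Fin (k i) → Bool)

namespace BitMetersEncodingScheme

variable (S : BitMetersEncodingScheme)

/-- The asymptotic rate is `R`. -/
def HasRate (R : ℝ) : Prop := Tendsto (fun i => (S.k i : ℝ) / S.n i) atTop (𝓝 R)

/-- Block error probability of the `i`-th code over the erasure channel. -/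
def Pe (ε : ℝ) (i : ℕ) : ℝ := blockErrorProb ε (S.encoder i).compute (S.decoder i)

/-- Energy (bit-meters) of the `i`-th encoder. -/
def E (i : ℕ) : ℝ := (S.encoder i).bitMeters

end BitMetersEncodingScheme

end

/-! ## Erasures and decoding -/

/-! Erasing the `p` output bits produced in a region of a circuit costs only a probability `ε ^ p`.
If fewer bits leave the region than input bits are injected into it, the decoder then fails with
probability at least one half (`le_blockErrorProb`). So if the error probability is below `ε ^ p /
2`, every region with at most `p` output bits emits at least as many bits as it takes in, and the
classes of any partition into such regions exchange at least `k` bits (`card_le_card_crossing`).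
Here `p` can be taken of order `|log f|` (`exists_number_of_erasures`); each bound comes from a
partition across which little can be communicated.

In the Thompson model, space and time are cut separately (`card_input_le`). A cut in time is crossed
by all memory and all wires, `O(mA)` bits; a cut in space by two bits per cycle for each cut wire.
Repeated bisection yields classes with at most `p` of the output nodes `O`, cutting `O(√(A |O| /
p))` sides of squares (`exists_partition`). Fully parallel: cutting space alone gives `n ≲ T √(A n /
p)`, that is `E T ≳ n p`; multiplying by `A ≥ n` gives `E ^ 2 ≳ n ^ 2 p`. Serial: cutting time
alone, into windows of `p / j` cycles. Exponent `1 / 5`: classes of `q ^ 2` output nodes and windows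
of `q ^ 3` cycles, so `p = q ^ 5`; both kinds of cut carry `O(A T / q)` bits.

In the bit-meters model, the regions are cubes of side `s` with `p = s ^ 3`. Averaging over `s`
shifts of the cubes, a message of length `ℓ` is cut by at most `3 ℓ` shifts, hence `s k ≤ 3 E`
(`side_mul_le_bitMeters`). When the logarithm is bounded, a linear bound on `E` is needed instead:
inputs that never communicate are protected by at most one output bit each, and linearly many of
them would make correct decoding exponentially unlikely (`one_sub_blockErrorProb_le`). -/

/-- The generating function of the number of positions of `O` that are not erased. -/
lemma sum_erasure_mul_pow (ε u : ℝ) {n : ℕ} (O : Finset (Fin n)) :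
    ∑ E : Finset (Fin n), ε ^ E.card * (1 - ε) ^ (n - E.card) * u ^ (O \ E).card =
      (ε + u * (1 - ε)) ^ O.card := by
  -- One factor per position: `ε` if it is erased, otherwise `1 - ε`, weighted by `u` inside `O`.
  -- Expanding with `Finset.prod_add` sums over the erased sets.
  have h1 : (∏ j : Fin n, (ε + (if j ∈ O then u else 1) * (1 - ε))) * 1 =
      (ε + u * (1 - ε)) ^ O.card := by
    rw [mul_one, ← Finset.prod_mul_prod_compl O, Finset.prod_congr rfl (g := fun _ => ε + u * (1 - ε)),
      Finset.prod_const, Finset.prod_congr (s₁ := Oᶜ) rfl (g := fun _ => (1 : ℝ)),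
      Finset.prod_const_one, mul_one]
    · intro j hj
      simp [Finset.mem_compl.1 hj]
    · intro j hj
      simp [hj]
  rw [← h1, mul_one, Finset.prod_add, Finset.powerset_univ]
  refine Finset.sum_congr rfl fun E _ => ?_
  rw [Finset.prod_const, Finset.prod_mul_distrib, Finset.prod_const, mul_assoc,
    mul_comm ((1 - ε) ^ _), ← Finset.compl_eq_univ_sdiff, Finset.card_compl, Fintype.card_fin]
  congr 2
  rw [Finset.prod_ite, Finset.prod_const, Finset.prod_const_one, mul_one]
  congr 2
  ext j
  simp [and_comm]

lemma sum_erasure (ε : ℝ) (n : ℕ) :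
    ∑ E : Finset (Fin n), ε ^ E.card * (1 - ε) ^ (n - E.card) = 1 := by
  simpa using sum_erasure_mul_pow ε 1 (∅ : Finset (Fin n))

open Classical in
/-- The messages that are decoded correctly when exactly the positions in `E` are erased. -/
def decodedCorrectly {k n : ℕ} (enc : (Fin k → Bool) → (Fin n → Bool))
    (dec : (Fin n → Option Bool) → (Fin k → Bool)) (E : Finset (Fin n)) :
    Finset (Fin k → Bool) :=
  Finset.univ.filter fun x => dec (erase E (enc x)) = x

/-- Exchanging the two sums fixes the erasure pattern first, after which bounding the error is a
matter of counting messages. -/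
lemma blockErrorProb_eq (ε : ℝ) {k n : ℕ} (enc : (Fin k → Bool) → (Fin n → Bool))
    (dec : (Fin n → Option Bool) → (Fin k → Bool)) :
    blockErrorProb ε enc dec = ∑ E : Finset (Fin n), ε ^ E.card * (1 - ε) ^ (n - E.card) *
      (1 - (decodedCorrectly enc dec E).card / 2 ^ k) := by
  classical
  unfold blockErrorProb
  simp_rw [Finset.mul_sum]
  rw [Finset.sum_comm]
  refine Finset.sum_congr rfl fun E _ => ?_
  simp_rw [mul_left_comm ((1 / 2 : ℝ) ^ k)]
  rw [← Finset.mul_sum]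
  congr 1
  rw [← Finset.mul_sum]
  have h1 : ∑ x : Fin k → Bool, (if dec (erase E (enc x)) = x then (0 : ℝ) else 1) =
      2 ^ k - (decodedCorrectly enc dec E).card := by
    rw [eq_sub_iff_add_eq, decodedCorrectly, Finset.card_filter]
    push_cast
    rw [← Finset.sum_add_distrib, Finset.sum_congr rfl (g := fun _ => (1 : ℝ))]
    · simp
    · intro x _
      split_ifs <;> simp
  rw [h1, div_pow, one_pow]
  field_simp

lemma card_decodedCorrectly_le_two_pow {k n : ℕ} (enc : (Fin k → Bool) → (Fin n → Bool))
    (dec : (Fin n → Option Bool) → (Fin k → Bool)) (E : Finset (Fin n)) :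
    ((decodedCorrectly enc dec E).card : ℝ) / 2 ^ k ≤ 1 := by
  rw [div_le_one (by positivity)]
  have := Finset.card_le_univ (decodedCorrectly enc dec E)
  simp only [Fintype.card_fun, Fintype.card_bool, Fintype.card_fin] at this
  exact_mod_cast this

lemma erasure_weight_nonneg {ε : ℝ} (h0 : 0 ≤ ε) (h1 : ε ≤ 1) (a b : ℕ) :
    0 ≤ ε ^ a * (1 - ε) ^ b :=
  mul_nonneg (pow_nonneg h0 _) (pow_nonneg (by linarith) _)

lemma blockErrorProb_nonneg {ε : ℝ} (h0 : 0 ≤ ε) (h1 : ε ≤ 1) {k n : ℕ}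
    (enc : (Fin k → Bool) → (Fin n → Bool)) (dec : (Fin n → Option Bool) → (Fin k → Bool)) :
    0 ≤ blockErrorProb ε enc dec := by
  rw [blockErrorProb_eq]
  exact Finset.sum_nonneg fun E _ => mul_nonneg (erasure_weight_nonneg h0 h1 _ _)
    (by linarith [card_decodedCorrectly_le_two_pow enc dec E])

/-- If, given the input bits outside `I`, the received word is a function of `τ`, then only a
fraction of `|β| / 2 ^ |I|` of the messages is decoded correctly. -/
lemma card_decodedCorrectly_mul_le {k n : ℕ} {enc : (Fin k → Bool) → (Fin n → Bool)}
    (dec : (Fin n → Option Bool) → (Fin k → Bool)) {E : Finset (Fin n)} (I : Finset (Fin k))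
    {β : Type*} [Fintype β] (τ : (Fin k → Bool) → β)
    (h : ∀ x x', (∀ i ∉ I, x i = x' i) → τ x = τ x' → erase E (enc x) = erase E (enc x')) :
    (decodedCorrectly enc dec E).card * 2 ^ I.card ≤ 2 ^ k * Fintype.card β := by
  classical
  -- On correctly decoded messages the pair (bits outside `I`, `τ`) is injective: it determines the
  -- received word, and this determines the message.
  have h1 : (decodedCorrectly enc dec E).card ≤
      (Finset.univ : Finset (({i // i ∉ I} → Bool) × β)).card := by
    refine Finset.card_le_card_of_injOn (fun x => (fun i => x i, τ x)) (fun _ _ => by simp) ?_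
    intro x hx x' hx' hxx
    simp only [decodedCorrectly, Finset.coe_filter, Finset.mem_univ, true_and,
      Set.mem_ofPred_eq] at hx hx'
    simp only [Prod.mk.injEq] at hxx
    rw [← hx, ← hx']
    exact congrArg dec (h x x' (fun i hi => congrFun hxx.1 ⟨i, hi⟩) hxx.2)
  have h2 : Fintype.card {i // i ∉ I} + I.card = k := by
    have := Fintype.card_subtype_compl (fun i => i ∈ I)
    have h3 := Finset.card_le_univ I
    simp only [Fintype.card_coe, Fintype.card_fin] at this h3
    omega
  simp only [Finset.card_univ, Fintype.card_prod, Fintype.card_fun, Fintype.card_bool] at h1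
  calc _ ≤ 2 ^ Fintype.card {i // i ∉ I} * Fintype.card β * 2 ^ I.card :=
        Nat.mul_le_mul_right _ h1
    _ = 2 ^ (Fintype.card {i // i ∉ I} + I.card) * Fintype.card β := by rw [pow_add]; ring
    _ = _ := by rw [h2]

/-- If, given the input bits outside `I`, less than `|I|` bits determine the output bits
outside `O`, then an error occurs with probability at least `1 / 2` when `O` is erased. -/
lemma le_blockErrorProb {ε : ℝ} (h0 : 0 ≤ ε) (h1 : ε ≤ 1) {k n : ℕ}
    {enc : (Fin k → Bool) → (Fin n → Bool)}
    (dec : (Fin n → Option Bool) → (Fin k → Bool)) (I : Finset (Fin k)) (O : Finset (Fin n))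
    {β : Type*} [Fintype β] (τ : (Fin k → Bool) → (β → Bool)) (hβ : Fintype.card β < I.card)
    (h : ∀ x x', (∀ i ∉ I, x i = x' i) → τ x = τ x' → ∀ j ∉ O, enc x j = enc x' j) :
    1 / 2 * ε ^ O.card ≤ blockErrorProb ε enc dec := by
  classical
  rw [blockErrorProb_eq]
  -- At `u = 0` only the patterns that erase all of `O` survive; their total weight is `ε ^ O.card`.
  have h2 := sum_erasure_mul_pow ε 0 O
  rw [zero_mul, add_zero] at h2
  rw [← h2, Finset.mul_sum]
  refine Finset.sum_le_sum fun E _ => ?_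
  have hw := erasure_weight_nonneg h0 h1 E.card (n - E.card)
  rw [mul_left_comm]
  refine mul_le_mul_of_nonneg_left ?_ hw
  by_cases hE : O ⊆ E
  · have h3 := card_decodedCorrectly_mul_le (E := E) (enc := enc) dec I τ (by
      intro x x' hx ht
      funext j
      unfold erase
      split_ifs with hj
      · rfl
      · rw [h x x' hx ht j (fun hjO => hj (hE hjO))])
    simp only [Fintype.card_fun, Fintype.card_bool] at h3
    have h4 : (decodedCorrectly enc dec E).card * 2 ≤ 2 ^ k := by
      have h5 : 2 ^ (Fintype.card β + 1) ≤ 2 ^ I.card := Nat.pow_le_pow_right (by norm_num) hβ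
      have h6 : (decodedCorrectly enc dec E).card * 2 * 2 ^ Fintype.card β ≤
          2 ^ k * 2 ^ Fintype.card β := by
        refine le_trans ?_ h3
        rw [mul_assoc, ← pow_succ']
        exact Nat.mul_le_mul_left _ h5
      exact Nat.le_of_mul_le_mul_right h6 (by positivity)
    have h7 : ((decodedCorrectly enc dec E).card : ℝ) / 2 ^ k ≤ 1 / 2 := by
      rw [div_le_div_iff₀ (by positivity) (by norm_num), one_mul]
      exact_mod_cast h4
    have h8 : O \ E = ∅ := Finset.sdiff_eq_empty_iff_subset.2 hE
    rw [h8]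
    simp only [Finset.card_empty, pow_zero]
    linarith
  · have h8 : (O \ E).card ≠ 0 := by
      rw [Finset.card_ne_zero, Finset.nonempty_iff_ne_empty, Ne, Finset.sdiff_eq_empty_iff_subset]
      exact hE
    rw [zero_pow h8, mul_zero]
    linarith [card_decodedCorrectly_le_two_pow enc dec E]

/-- Assign colours to the input bits, to the output bits and to the sender and the receiver of each
communicated bit. If no colour has more than `p` output bits, and the error probability is less
than `ε ^ p / 2`, then at least `k` bits are communicated between different colours. -/
theorem card_le_card_crossing {ε : ℝ} (h0 : 0 ≤ ε) (h1 : ε ≤ 1) {k n : ℕ}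
    {enc : (Fin k → Bool) → (Fin n → Bool)}
    {dec : (Fin n → Option Bool) → (Fin k → Bool)} {κ β : Type*} [DecidableEq κ] [Fintype β]
    (sender receiver : β → κ) (bit : (Fin k → Bool) → β → Bool) (cin : Fin k → κ)
    (cout : Fin n → κ)
    (hc : ∀ P x x', (∀ i, cin i ≠ P → x i = x' i) →
      (∀ b, sender b = P → receiver b ≠ P → bit x b = bit x' b) →
      ∀ j, cout j ≠ P → enc x j = enc x' j)
    {p : ℕ} (hp : ∀ P, (Finset.univ.filter fun j => cout j = P).card ≤ p)
    (hPe : blockErrorProb ε enc dec < 1 / 2 * ε ^ p) :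
    k ≤ (Finset.univ.filter fun b => sender b ≠ receiver b).card := by
  classical
  -- If a colour emitted fewer bits than it has input bits, erasing its at most `p` output bits
  -- would already force the excluded error probability.
  have hP : ∀ P, (Finset.univ.filter fun i => cin i = P).card ≤
      (Finset.univ.filter fun b => sender b = P ∧ receiver b ≠ P).card := by
    intro P
    by_contra hlt
    push Not at hlt
    refine absurd (le_blockErrorProb h0 h1 (enc := enc) dec (Finset.univ.filter fun i => cin i = P)
      (Finset.univ.filter fun j => cout j = P)
      (β := {b // sender b = P ∧ receiver b ≠ P}) (fun x b => bit x b) ?_ ?_) ?_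
    · rwa [Fintype.card_subtype]
    · intro x x' hx ht j hj
      refine hc P x x' (fun i hi => hx i (by simpa using hi)) (fun b hb hb' => ?_) j
        (by simpa using hj)
      exact congrFun ht ⟨b, hb, hb'⟩
    · push Not
      refine hPe.trans_le ?_
      have := pow_le_pow_of_le_one h0 h1 (hp P)
      linarith
  -- The colour type may be infinite; these are the colours that can contribute to either count.
  let K : Finset κ := Finset.univ.image cin ∪ Finset.univ.image sender
  calc k = (Finset.univ : Finset (Fin k)).card := by simp
    _ = ∑ P ∈ K, (Finset.univ.filter fun i => cin i = P).card :=
        Finset.card_eq_sum_card_fiberwise (fun i _ => by simp [K])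
    _ ≤ ∑ P ∈ K, (Finset.univ.filter fun b => sender b = P ∧ receiver b ≠ P).card :=
        Finset.sum_le_sum fun P _ => hP P
    _ = ∑ P ∈ K, ((Finset.univ.filter fun b => sender b ≠ receiver b).filter
          fun b => sender b = P).card := by
        refine Finset.sum_congr rfl fun P _ => congrArg _ ?_
        ext b
        simp only [Finset.mem_filter, Finset.mem_univ, true_and]
        constructor
        · rintro ⟨rfl, h⟩
          exact ⟨h.symm, rfl⟩
        · rintro ⟨h, rfl⟩
          exact ⟨rfl, h.symm⟩
    _ = _ := (Finset.card_eq_sum_card_fiberwise (fun b _ => by simp [K])).symm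

/-! ## Cutting a finite set of squares -/

lemma exists_le_lt_succ (g : ℤ → ℕ) {M : ℕ} {a b : ℤ} (hab : a ≤ b) (ha : g a ≤ M) (hb : M < g b) :
    ∃ x, g x ≤ M ∧ M < g (x + 1) := by
  by_contra! h
  have : ∀ d : ℕ, g (a + d) ≤ M := by
    intro d
    induction d with
    | zero => simpa using ha
    | succ d ih =>
      have := h _ ih
      push_cast
      rwa [← add_assoc]
  have h2 := this (b - a).toNat
  rw [Int.toNat_of_nonneg (by omega)] at h2
  rw [add_sub_cancel] at h2
  omega

/-- For a finite set and a coordinate, a threshold for which at most `M` elements lie below it and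
more than `M` elements lie below the next one. -/
lemma exists_threshold {α : Type*} (O : Finset α) (c : α → ℤ) (B : Set α) [DecidablePred (· ∈ B)]
    (M : ℕ) (hB : (O.filter (· ∈ B)).card ≤ M) {U : Set α} [DecidablePred (· ∈ U)]
    (hU : M < (O.filter fun o => o ∈ B ∨ o ∈ U).card) :
    ∃ y : ℤ, (O.filter fun o => o ∈ B ∨ o ∈ U ∧ c o < y).card ≤ M ∧
      M < (O.filter fun o => o ∈ B ∨ o ∈ U ∧ c o < y + 1).card := by
  obtain ⟨N, hN⟩ : ∃ N : ℕ, ∀ o ∈ O, |c o| < N := by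
    refine ⟨O.sup (fun o => (c o).natAbs) + 1, fun o ho => ?_⟩
    have h1 : (c o).natAbs ≤ O.sup (fun o => (c o).natAbs) :=
      Finset.le_sup (f := fun o => (c o).natAbs) ho
    rw [Int.abs_eq_natAbs]
    omega
  refine exists_le_lt_succ (fun y => (O.filter fun o => o ∈ B ∨ o ∈ U ∧ c o < y).card)
    (a := -N) (b := N) (by omega) ?_ ?_
  · refine le_trans (Finset.card_le_card fun o ho => ?_) hB
    simp only [Finset.mem_filter] at ho ⊢
    have := abs_lt.1 (hN o ho.1)
    exact ⟨ho.1, ho.2.resolve_right fun h => by omega⟩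
  · refine hU.trans_le (Finset.card_le_card fun o ho => ?_)
    simp only [Finset.mem_filter] at ho ⊢
    have := abs_lt.1 (hN o ho.1)
    exact ⟨ho.1, ho.2.imp_right fun h => ⟨h, this.2⟩⟩

/-- Among `s` consecutive columns there is one with at most `s` elements of `Q` if `|Q| ≤ s ^ 2`. -/
lemma exists_sparse_column (Q : Finset (ℤ × ℤ)) (s : ℕ) (hs : 0 < s) (hQ : Q.card ≤ s * s) (x : ℤ) :
    ∃ x', x ≤ x' ∧ x' < x + s ∧ (Q.filter fun q => q.1 = x').card ≤ s := by
  by_contra! h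
  have h1 : ∑ x' ∈ Finset.Ico x (x + s), (Q.filter fun q => q.1 = x').card ≤ Q.card := by
    have := Finset.card_eq_sum_card_fiberwise (s := Q.filter fun q => q.1 ∈ Finset.Ico x (x + s))
      (f := fun q => q.1) (t := Finset.Ico x (x + s)) (by
        intro q hq
        simp only [Finset.coe_filter, Set.mem_ofPred_eq] at hq
        exact hq.2)
    refine le_trans (le_of_eq ?_) (Finset.card_filter_le Q fun q => q.1 ∈ Finset.Ico x (x + s))
    rw [this]
    refine Finset.sum_congr rfl fun x' hx' => congrArg _ ?_
    ext q
    simp only [Finset.mem_filter, and_assoc]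
    constructor
    · rintro ⟨h1, rfl⟩
      exact ⟨h1, hx', rfl⟩
    · rintro ⟨h1, -, h2⟩
      exact ⟨h1, h2⟩
  have h2 : ∑ x' ∈ Finset.Ico x (x + s), (s + 1) ≤
      ∑ x' ∈ Finset.Ico x (x + s), (Q.filter fun q => q.1 = x').card :=
    Finset.sum_le_sum fun x' hx' => by
      rw [Finset.mem_Ico] at hx'
      exact h x' hx'.1 hx'.2
  simp only [Finset.sum_const, Int.card_Ico, smul_eq_mul] at h2
  have h3 : (x + s - x).toNat = s := by omega
  rw [h3] at h2
  nlinarith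

lemma gridGraph_adj_iff {p q : ℤ × ℤ} : gridGraph.Adj p q ↔
    (p.1 = q.1 ∧ (p.2 + 1 = q.2 ∨ q.2 + 1 = p.2)) ∨ (p.2 = q.2 ∧ (p.1 + 1 = q.1 ∨ q.1 + 1 = p.1)) := by
  change |p.1 - q.1| + |p.2 - q.2| = 1 ↔ _
  rw [Int.abs_eq_natAbs, Int.abs_eq_natAbs]
  omega

open Classical in
lemma card_filter_mem_add_card_filter_notMem {α : Type*} (O : Finset α) (S : Set α) :
    (O.filter (· ∈ S)).card + (O.filter (· ∉ S)).card = O.card := by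
  rw [← Finset.card_filter_add_card_filter_not (s := O) (· ∈ S)]

open Classical in
/-- The ordered pairs of adjacent squares of `Q` whose colours differ. -/
noncomputable def bichromatic {κ : Type*} (Q : Finset (ℤ × ℤ)) (χ : ℤ × ℤ → κ) : Finset ((ℤ × ℤ) × (ℤ × ℤ)) :=
  (Q ×ˢ Q).filter fun e => gridGraph.Adj e.1 e.2 ∧ χ e.1 ≠ χ e.2

lemma mem_bichromatic {κ : Type*} {Q : Finset (ℤ × ℤ)} {χ : ℤ × ℤ → κ} {e : (ℤ × ℤ) × (ℤ × ℤ)} :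
    e ∈ bichromatic Q χ ↔ (e.1 ∈ Q ∧ e.2 ∈ Q) ∧ gridGraph.Adj e.1 e.2 ∧ χ e.1 ≠ χ e.2 := by
  simp [bichromatic]

open Classical in
/-- Bisection of a set `O` along a short cut through `Q`. -/
lemma exists_bisection_cut (Q O : Finset (ℤ × ℤ)) (M s : ℕ) (hs : 0 < s) (hQ : Q.card ≤ s * s)
    (hO : O.card ≤ 2 * M) :
    ∃ S : Set (ℤ × ℤ), (O.filter (· ∈ S)).card ≤ M ∧ (O.filter (· ∉ S)).card ≤ M ∧
      ((Q ×ˢ Q).filter fun e => gridGraph.Adj e.1 e.2 ∧ e.1 ∈ S ∧ e.2 ∉ S).card ≤ 4 * s := by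
  rcases le_or_gt O.card M with hM | hM
  · refine ⟨Set.univ, ?_, ?_, ?_⟩
    · simpa using hM
    · simp
    · simp
  -- Column `x₀` contains the median of `O`. The sparse columns satisfy `x₁ ≤ x₀ < x₂` and `x₂ - x₁
  -- ≤ 2 * s - 1`; the median is then located within the strip between them, first by row `y₀` and
  -- then by position `z` in that row.
  obtain ⟨x₀, hx₀, hx₀'⟩ := exists_threshold O Prod.fst ∅ M (U := Set.univ) (by simp) (by simpa using hM)
  obtain ⟨x₁, h1, h1', hc1⟩ := exists_sparse_column Q s hs hQ (x₀ - s + 1)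
  obtain ⟨x₂, h2, h2', hc2⟩ := exists_sparse_column Q s hs hQ (x₀ + 1)
  obtain ⟨y₀, hy₀, hy₀'⟩ := exists_threshold O Prod.snd {o | o.1 < x₁} M
    (U := {o | x₁ ≤ o.1 ∧ o.1 < x₂})
    (by
      refine le_trans (Finset.card_le_card fun o ho => ?_) hx₀
      simp only [Finset.mem_filter, Set.mem_ofPred_eq, Set.mem_empty_iff_false, Set.mem_univ] at ho ⊢
      refine ⟨ho.1, Or.inr ⟨trivial, by omega⟩⟩)
    (by
      refine hx₀'.trans_le (Finset.card_le_card fun o ho => ?_)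
      simp only [Finset.mem_filter, Set.mem_ofPred_eq, Set.mem_empty_iff_false, Set.mem_univ, false_or,
        true_and] at ho ⊢
      exact ⟨ho.1, by omega⟩)
  obtain ⟨z, hz, hz'⟩ := exists_threshold O Prod.fst
    {o | o.1 < x₁ ∨ (x₁ ≤ o.1 ∧ o.1 < x₂) ∧ o.2 < y₀} M
    (U := {o | (x₁ ≤ o.1 ∧ o.1 < x₂) ∧ o.2 = y₀})
    (by simpa using hy₀)
    (by
      refine hy₀'.trans_le (Finset.card_le_card fun o ho => ?_)
      simp only [Finset.mem_filter, Set.mem_ofPred_eq] at ho ⊢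
      exact ⟨ho.1, by omega⟩)
  obtain ⟨S, hS⟩ : ∃ S : Set (ℤ × ℤ), ∀ o, o ∈ S ↔
      (o.1 < x₁ ∨ (x₁ ≤ o.1 ∧ o.1 < x₂) ∧ (o.2 < y₀ ∨ o.2 = y₀ ∧ o.1 < z)) :=
    ⟨{o | o.1 < x₁ ∨ (x₁ ≤ o.1 ∧ o.1 < x₂) ∧ (o.2 < y₀ ∨ o.2 = y₀ ∧ o.1 < z)}, fun _ => Iff.rfl⟩
  refine ⟨S, ?_, ?_, ?_⟩
  · refine le_trans (Finset.card_le_card fun o ho => ?_) hz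
    simp only [Finset.mem_filter, Set.mem_ofPred_eq, hS] at ho ⊢
    exact ⟨ho.1, by omega⟩
  · have h3 : (O.filter (· ∈ S)).card + 1 ≥ M + 1 := by
      refine le_trans hz' (le_trans (Finset.card_le_card (t := insert (z, y₀) _) ?_)
        (Finset.card_insert_le (z, y₀) _))
      intro o ho
      simp only [Finset.mem_filter, Set.mem_ofPred_eq, Finset.mem_insert, Prod.ext_iff, hS] at ho ⊢
      have := ho.1
      simp only [this, true_and]
      omega
    have h4 := card_filter_mem_add_card_filter_notMem O S
    omega
  -- The boundary is a staircase: `f` lists the vertical sides in the two sparse columns (at most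
  -- `s` each), `g` one horizontal side per column of the strip (at most `2 * s - 1`), and one
  -- vertical side remains at `z`; in all `4 * s`.
  · let f : ℤ × ℤ → (ℤ × ℤ) × (ℤ × ℤ) := fun q => ((q.1 - 1, q.2), q)
    let g : ℤ → (ℤ × ℤ) × (ℤ × ℤ) :=
      fun x => if x < z then ((x, y₀), (x, y₀ + 1)) else ((x, y₀ - 1), (x, y₀))
    have hsub : ((Q ×ˢ Q).filter fun e => gridGraph.Adj e.1 e.2 ∧ e.1 ∈ S ∧ e.2 ∉ S) ⊆
        (((Q.filter fun q => q.1 = x₁).image f ∪ (Q.filter fun q => q.1 = x₂).image f) ∪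
          (Finset.Ico x₁ x₂).image g) ∪ {((z - 1, y₀), (z, y₀))} := by
      rintro ⟨⟨a, b⟩, ⟨c, d⟩⟩ he
      simp only [Finset.mem_filter, Finset.mem_product, gridGraph_adj_iff, hS] at he
      obtain ⟨⟨-, hq⟩, hadj, hp, hnp⟩ := he
      simp only [Finset.mem_union, Finset.mem_image, Finset.mem_filter, Finset.mem_Ico,
        Finset.mem_singleton, Prod.mk.injEq, f]
      by_cases hl1 : a < c ∧ c = x₁
      · exact Or.inl (Or.inl (Or.inl ⟨(c, d), ⟨hq, hl1.2⟩, by omega, rfl⟩))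
      by_cases hl2 : a < c ∧ c = x₂
      · exact Or.inl (Or.inl (Or.inr ⟨(c, d), ⟨hq, hl2.2⟩, by omega, rfl⟩))
      by_cases hl3 : a < c
      · right
        omega
      · refine Or.inl (Or.inr ⟨a, by omega, ?_⟩)
        simp only [g]
        rcases hadj with ⟨h5, h6⟩ | ⟨h5, h6⟩
        · split_ifs with hz <;> simp only [Prod.mk.injEq, true_and] <;> omega
        · omega
    refine (Finset.card_le_card hsub).trans ?_
    have e1 := Finset.card_union_le (((Q.filter fun q => q.1 = x₁).image f ∪
      (Q.filter fun q => q.1 = x₂).image f) ∪ (Finset.Ico x₁ x₂).image g) {((z - 1, y₀), (z, y₀))}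
    have e2 := Finset.card_union_le ((Q.filter fun q => q.1 = x₁).image f ∪
      (Q.filter fun q => q.1 = x₂).image f) ((Finset.Ico x₁ x₂).image g)
    have e3 := Finset.card_union_le ((Q.filter fun q => q.1 = x₁).image f)
      ((Q.filter fun q => q.1 = x₂).image f)
    have e4 := Finset.card_image_le (s := Q.filter fun q => q.1 = x₁) (f := f)
    have e5 := Finset.card_image_le (s := Q.filter fun q => q.1 = x₂) (f := f)
    have e6 := Finset.card_image_le (s := Finset.Ico x₁ x₂) (f := g)
    rw [Int.card_Ico] at e6
    rw [Finset.card_singleton] at e1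
    omega

-- The cut is taken with `s = Nat.sqrt Q.card + 1`. Counting sides in both directions doubles `4 *
-- s`, and `s ≤ 2 * Nat.sqrt Q.card` for nonempty `Q` turns this into the factor 16.
open Classical in
lemma exists_bisection (Q O : Finset (ℤ × ℤ)) (M : ℕ) (hO : O.card ≤ 2 * M) :
    ∃ S : Set (ℤ × ℤ), (O.filter (· ∈ S)).card ≤ M ∧ (O.filter (· ∉ S)).card ≤ M ∧
      ((bichromatic Q (· ∈ S)).card : ℝ) ≤ 16 * Real.sqrt Q.card := by
  rcases Nat.eq_zero_or_pos Q.card with h0 | h0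
  · obtain ⟨S, h1, h2, -⟩ := exists_bisection_cut Q O M 1 one_pos (by omega) hO
    refine ⟨S, h1, h2, ?_⟩
    rw [Finset.card_eq_zero] at h0
    subst h0
    simp [bichromatic]
  obtain ⟨S, h1, h2, h3⟩ := exists_bisection_cut Q O M (Nat.sqrt Q.card + 1) (by omega)
    (Nat.lt_succ_sqrt _).le hO
  refine ⟨S, h1, h2, ?_⟩
  have h4 : bichromatic Q (· ∈ S) ⊆
      ((Q ×ˢ Q).filter fun e => gridGraph.Adj e.1 e.2 ∧ e.1 ∈ S ∧ e.2 ∉ S) ∪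
      ((Q ×ˢ Q).filter fun e => gridGraph.Adj e.1 e.2 ∧ e.1 ∈ S ∧ e.2 ∉ S).image Prod.swap := by
    rintro ⟨a, b⟩ he
    simp only [bichromatic, Finset.mem_filter, Finset.mem_product, ne_eq, eq_iff_iff] at he
    simp only [Finset.mem_union, Finset.mem_image, Finset.mem_filter, Finset.mem_product]
    obtain ⟨⟨ha, hb⟩, hab, hS⟩ := he
    by_cases haS : a ∈ S
    · exact Or.inl ⟨⟨ha, hb⟩, hab, haS, by tauto⟩
    · exact Or.inr ⟨(b, a), ⟨⟨hb, ha⟩, hab.symm, by tauto, haS⟩, rfl⟩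
  have h5 := (Finset.card_le_card h4).trans (Finset.card_union_le _ _)
  have h6 := Finset.card_image_le
    (s := (Q ×ˢ Q).filter fun e => gridGraph.Adj e.1 e.2 ∧ e.1 ∈ S ∧ e.2 ∉ S) (f := Prod.swap)
  have h7 : (bichromatic Q (· ∈ S)).card ≤ 16 * Nat.sqrt Q.card := by
    have := Nat.sqrt_pos.2 h0
    omega
  calc ((bichromatic Q (· ∈ S)).card : ℝ) ≤ 16 * (Nat.sqrt Q.card : ℝ) := by exact_mod_cast h7
    _ ≤ _ := by
      have := Real.nat_sqrt_le_real_sqrt (a := Q.card)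
      linarith

/-! ### Repeated bisection -/

lemma sqrt_add_sqrt_le {a b : ℝ} (ha : 0 ≤ a) (hb : 0 ≤ b) :
    Real.sqrt a + Real.sqrt b ≤ Real.sqrt 2 * Real.sqrt (a + b) := by
  rw [← Real.sqrt_mul (by norm_num)]
  refine Real.le_sqrt_of_sq_le ?_
  nlinarith [Real.sq_sqrt ha, Real.sq_sqrt hb, sq_nonneg (Real.sqrt a - Real.sqrt b)]

open Classical in
/-- Repeated bisection: `2 ^ j` classes with at most `p` elements of `O` each. -/
lemma exists_partition_pow (p j : ℕ) : ∀ Q O : Finset (ℤ × ℤ), O.card ≤ p * 2 ^ j →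
    ∃ χ : ℤ × ℤ → ℕ, (∀ a, (O.filter fun o => χ o = a).card ≤ p) ∧
      ((bichromatic Q χ).card : ℝ) ≤ 40 * (Real.sqrt 2 ^ j - 1) * Real.sqrt Q.card := by
  induction j with
  | zero =>
    intro Q O hO
    refine ⟨fun _ => 0, fun a => (Finset.card_filter_le _ _).trans (by simpa using hO), ?_⟩
    simp [bichromatic]
  | succ j ih =>
    intro Q O hO
    obtain ⟨S, h1, h2, h3⟩ := exists_bisection Q O (p * 2 ^ j) (by rw [pow_succ] at hO; linarith)
    obtain ⟨χ₁, h4, h5⟩ := ih (Q.filter (· ∈ S)) _ h1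
    obtain ⟨χ₂, h6, h7⟩ := ih (Q.filter (· ∉ S)) _ h2
    -- Even and odd colours keep the classes of the two halves apart.
    refine ⟨fun v => if v ∈ S then 2 * χ₁ v else 2 * χ₂ v + 1, fun a => ?_, ?_⟩
    · rcases Nat.even_or_odd' a with ⟨b, rfl | rfl⟩
      · refine le_trans (Finset.card_le_card fun o ho => ?_) (h4 b)
        simp only [Finset.mem_filter] at ho ⊢
        obtain ⟨ho, ho'⟩ := ho
        split_ifs at ho' with hS
        · exact ⟨⟨ho, hS⟩, by omega⟩
        · omega
      · refine le_trans (Finset.card_le_card fun o ho => ?_) (h6 b)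
        simp only [Finset.mem_filter] at ho ⊢
        obtain ⟨ho, ho'⟩ := ho
        split_ifs at ho' with hS
        · omega
        · exact ⟨⟨ho, hS⟩, by omega⟩
    · have hsub : bichromatic Q (fun v => if v ∈ S then 2 * χ₁ v else 2 * χ₂ v + 1) ⊆
          bichromatic Q (· ∈ S) ∪ (bichromatic (Q.filter (· ∈ S)) χ₁ ∪
            bichromatic (Q.filter (· ∉ S)) χ₂) := by
        rintro ⟨a, b⟩ he
        simp only [bichromatic, Finset.mem_filter, Finset.mem_product, Finset.mem_union, ne_eq,
          eq_iff_iff] at he ⊢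
        obtain ⟨⟨ha, hb⟩, hab, hne⟩ := he
        by_cases haS : a ∈ S <;> by_cases hbS : b ∈ S <;> simp [haS, hbS] at hne <;> tauto
      have h8 : (bichromatic Q (fun v => if v ∈ S then 2 * χ₁ v else 2 * χ₂ v + 1)).card ≤
          (bichromatic Q (· ∈ S)).card + ((bichromatic (Q.filter (· ∈ S)) χ₁).card +
            (bichromatic (Q.filter (· ∉ S)) χ₂).card) :=
        (Finset.card_le_card hsub).trans ((Finset.card_union_le _ _).trans
          (Nat.add_le_add_left (Finset.card_union_le _ _) _))
      have h9 : ((Q.filter (· ∈ S)).card : ℝ) + (Q.filter (· ∉ S)).card = Q.card := by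
        exact_mod_cast card_filter_mem_add_card_filter_notMem Q S
      have h10 := sqrt_add_sqrt_le (Nat.cast_nonneg (α := ℝ) (Q.filter (· ∈ S)).card)
        (Nat.cast_nonneg (Q.filter (· ∉ S)).card)
      rw [h9] at h10
      -- The constant 40 closes the recursion: `16 + √2 * 40 * (√2 ^ j - 1) ≤ 40 * (√2 ^ (j + 1) -
      -- 1)` amounts to `√2 ≥ 1.4`.
      have hs : (1.4 : ℝ) ≤ Real.sqrt 2 := Real.le_sqrt_of_sq_le (by norm_num)
      have h11 : (0 : ℝ) ≤ 40 * (Real.sqrt 2 ^ j - 1) := by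
        have := one_le_pow₀ (n := j) (show (1 : ℝ) ≤ Real.sqrt 2 by linarith)
        linarith
      calc _ ≤ ((bichromatic Q (· ∈ S)).card : ℝ) + ((bichromatic (Q.filter (· ∈ S)) χ₁).card +
            (bichromatic (Q.filter (· ∉ S)) χ₂).card) := by exact_mod_cast h8
        _ ≤ 16 * Real.sqrt Q.card + 40 * (Real.sqrt 2 ^ j - 1) *
            (Real.sqrt (Q.filter (· ∈ S)).card + Real.sqrt (Q.filter (· ∉ S)).card) := by
          linarith
        _ ≤ 16 * Real.sqrt Q.card + 40 * (Real.sqrt 2 ^ j - 1) *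
            (Real.sqrt 2 * Real.sqrt Q.card) := by
          have := mul_le_mul_of_nonneg_left h10 h11
          linarith
        _ ≤ _ := by
          rw [pow_succ]
          have := mul_nonneg (show (0 : ℝ) ≤ Real.sqrt 2 - 1.4 by linarith)
            (Real.sqrt_nonneg (Q.card : ℝ))
          nlinarith

open Classical in
/-- A partition of the plane into classes with at most `p` elements of `O` each that cuts `Q` along
at most `O(√(|Q| |O| / p))` sides. -/
lemma exists_partition (Q O : Finset (ℤ × ℤ)) (p : ℕ) (hp : 0 < p) :
    ∃ χ : ℤ × ℤ → ℕ, (∀ a, (O.filter fun o => χ o = a).card ≤ p) ∧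
      ((bichromatic Q χ).card : ℝ) ≤ 80 * Real.sqrt (Q.card * O.card / p) := by
  have hex : ∃ j, O.card ≤ p * 2 ^ j :=
    ⟨O.card, (Nat.lt_two_pow_self).le.trans (Nat.le_mul_of_pos_left _ hp)⟩
  -- The least sufficient depth: by minimality `2 ^ j` is at most `2 * O.card / p`, unless no cut is
  -- needed at all.
  obtain ⟨χ, h1, h2⟩ := exists_partition_pow p (Nat.find hex) Q O (Nat.find_spec hex)
  refine ⟨χ, h1, h2.trans ?_⟩
  rcases Nat.eq_zero_or_pos (Nat.find hex) with h0 | h0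
  · rw [h0, pow_zero, sub_self, mul_zero, zero_mul]
    positivity
  · have h3 := Nat.find_min hex (Nat.sub_lt h0 one_pos)
    push Not at h3
    have h4 : p * 2 ^ Nat.find hex ≤ 2 * O.card := by
      obtain ⟨i, hi⟩ := Nat.exists_eq_succ_of_ne_zero h0.ne'
      rw [hi] at h3 ⊢
      simp only [Nat.succ_eq_add_one, Nat.add_sub_cancel] at h3
      rw [pow_succ]
      linarith
    have hp' : (0 : ℝ) < p := by exact_mod_cast hp
    have h5 : (2 : ℝ) ^ Nat.find hex ≤ 2 * O.card / p := by
      rw [le_div_iff₀ hp', mul_comm]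
      exact_mod_cast h4
    have h6 : Real.sqrt 2 ^ Nat.find hex ≤ 2 * Real.sqrt (O.card / p) := by
      have h7 : Real.sqrt 2 ^ Nat.find hex = Real.sqrt (2 ^ Nat.find hex) := by
        rw [Real.sqrt_eq_rpow, Real.sqrt_eq_rpow, ← Real.rpow_natCast, ← Real.rpow_natCast,
          ← Real.rpow_mul (by norm_num), ← Real.rpow_mul (by norm_num), mul_comm]
      rw [h7]
      refine Real.sqrt_le_iff.2 ⟨by positivity, ?_⟩
      rw [mul_pow, Real.sq_sqrt (by positivity)]
      refine h5.trans ?_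
      rw [mul_div_assoc]
      have : (0 : ℝ) ≤ O.card / p := by positivity
      linarith
    rw [mul_div_assoc, Real.sqrt_mul (by positivity)]
    have h8 := Real.sqrt_nonneg (Q.card : ℝ)
    have h9 : 40 * (Real.sqrt 2 ^ Nat.find hex - 1) ≤ 80 * Real.sqrt (O.card / p) := by linarith
    have := mul_le_mul_of_nonneg_right h9 h8
    linarith

lemma card_bichromatic_le {κ : Type*} (Q : Finset (ℤ × ℤ)) (χ : ℤ × ℤ → κ) :
    (bichromatic Q χ).card ≤ 4 * Q.card := by
  classical
  have hsub : bichromatic Q χ ⊆ (Q ×ˢ ({(1, 0), (-1, 0), (0, 1), (0, -1)} : Finset (ℤ × ℤ))).image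
      (fun e => (e.1, e.1 + e.2)) := by
    rintro ⟨⟨a, b⟩, ⟨c, d⟩⟩ he
    simp only [bichromatic, Finset.mem_filter, Finset.mem_product, gridGraph_adj_iff] at he
    simp only [Finset.mem_image, Finset.mem_product, Finset.mem_insert, Finset.mem_singleton]
    refine ⟨((a, b), (c - a, d - b)), ⟨he.1.1, ?_⟩, by simp⟩
    simp only [Prod.mk.injEq]
    have := he.2.1
    omega
  refine (Finset.card_le_card hsub).trans (Finset.card_image_le.trans ?_)
  rw [Finset.card_product, mul_comm]
  exact Nat.mul_le_mul_right _ Finset.card_le_four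

/-! ## The flow of information in a circuit -/

/-- The squares occupied by a layout. -/
def Layout.occupied (Λ : Layout) : Finset (ℤ × ℤ) :=
  Λ.nodes ∪ Finset.univ.biUnion fun w => (Λ.route w).support.toFinset

lemma Layout.card_occupied (Λ : Layout) : Λ.occupied.card = Λ.area := rfl

lemma Layout.card_nodes_le (Λ : Layout) : Λ.nodes.card ≤ Λ.area :=
  Finset.card_le_card Finset.subset_union_left

/-- Somewhere along a wire with differently coloured ends the colour changes across a side of a
square. Routes share no side, so different wires get different sides. -/
lemma Layout.card_bichromatic_wires_le (Λ : Layout) {κ : Type*} [DecidableEq κ] (χ : ℤ × ℤ → κ) :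
    (Finset.univ.filter fun w => χ (Λ.src w) ≠ χ (Λ.dst w)).card ≤
      (bichromatic Λ.occupied χ).card := by
  classical
  have h : ∀ w : Fin Λ.numWires, ∃ e : (ℤ × ℤ) × (ℤ × ℤ), χ (Λ.src w) ≠ χ (Λ.dst w) →
      s(e.1, e.2) ∈ (Λ.route w).edges ∧ e ∈ bichromatic Λ.occupied χ := by
    intro w
    by_cases hw : χ (Λ.src w) ≠ χ (Λ.dst w)
    · obtain ⟨d, hd, h1, h2⟩ := (Λ.route w).exists_boundary_dart {q | χ q = χ (Λ.src w)} rfl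
        (fun h => hw (by simpa using h.symm))
      refine ⟨(d.fst, d.snd), fun _ => ⟨List.mem_map.2 ⟨d, hd, rfl⟩, ?_⟩⟩
      have hs : ∀ q ∈ (Λ.route w).support, q ∈ Λ.occupied := fun q hq =>
        Finset.mem_union_right _ (Finset.mem_biUnion.2 ⟨w, Finset.mem_univ _, by simpa using hq⟩)
      refine mem_bichromatic.2 ⟨⟨hs _ ?_, hs _ ?_⟩, d.adj, ?_⟩
      · exact (Λ.route w).dart_fst_mem_support_of_mem_darts hd
      · exact (Λ.route w).dart_snd_mem_support_of_mem_darts hd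
      · exact fun h => h2 (h.symm.trans h1)
    · exact ⟨0, fun h => absurd h hw⟩
  choose e he using h
  refine Finset.card_le_card_of_injOn e (fun w hw => (he w (by simpa using hw)).2) ?_
  intro w hw w' hw' hww
  by_contra hne
  have h1 := (he w (by simpa using hw)).1
  have h2 := (he w' (by simpa using hw')).1
  rw [← hww] at h2
  exact Λ.route_disjoint w w' hne _ h1 h2

/-- Under the colouring by the identity every wire counts as cut. -/
lemma Layout.numWires_le (Λ : Layout) : Λ.numWires ≤ 4 * Λ.area := by
  refine le_trans ?_ (card_bichromatic_le Λ.occupied id)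
  refine le_trans (le_of_eq ?_) (Λ.card_bichromatic_wires_le id)
  simp [Λ.src_ne_dst]

/-- Each change raises the monotone `φ` by at least one, so the values reached after changes are
distinct elements of `[1, φ T]`. -/
lemma card_changes_le {φ : ℕ → ℕ} (hφ : Monotone φ) (T : ℕ) :
    (Finset.univ.filter fun t : Fin T => φ t ≠ φ (t + 1)).card ≤ φ T := by
  have h := Finset.card_le_card_of_injOn
    (s := Finset.univ.filter fun t : Fin T => φ t ≠ φ (t + 1)) (t := Finset.Icc 1 (φ T))
    (fun t => φ (t + 1)) (by
      intro t ht
      have h1 : φ t ≠ φ (t + 1) := by simpa using ht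
      have h2 := hφ (Nat.le_succ t)
      have h3 := hφ (Nat.succ_le_of_lt t.2)
      simp only [Nat.succ_eq_add_one] at h2 h3
      simp only [Finset.coe_Icc, Set.mem_Icc]
      omega) (by
      have key : ∀ t t' : Fin T, φ t' ≠ φ (t' + 1) → t < t' → φ (t + 1) ≠ φ (t' + 1) := by
        intro t t' h1 htt
        have h2 := hφ (Nat.le_succ t')
        have h3 : φ (t + 1) ≤ φ t' := hφ (Nat.succ_le_of_lt htt)
        simp only [Nat.succ_eq_add_one] at h2
        omega
      intro t ht t' ht' htt
      rcases lt_trichotomy t t' with h1 | h1 | h1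
      · exact absurd htt (key t t' (by simpa using ht') h1)
      · exact h1
      · exact absurd htt.symm (key t' t (by simpa using ht) h1))
  simpa using h

namespace Circuit

variable {m k n : ℕ} (C : Circuit m k n)

/-- What node `v` computes in cycle `t` on input `x`. -/
noncomputable def result (x : Fin k → Bool) (t : Fin C.T) (v : ℤ × ℤ) :
    (Fin m → Bool) × (Fin C.numWires → Bool) × Bool :=
  C.nodeResult x (C.configAt x t) t v

lemma compute_apply (x : Fin k → Bool) (i : Fin n) :
    C.compute x i = (C.result x (C.outPort i).2 (C.outPort i).1).2.2 := rfl

lemma configAt_succ (x : Fin k → Bool) (t : ℕ) (ht : t < C.T) :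
    C.configAt x (t + 1) = C.next x (C.configAt x t) ⟨t, ht⟩ := by
  rw [configAt, dif_pos ht]

lemma inputAt_congr {x x' : Fin k → Bool} {v : ℤ × ℤ} {t : Fin C.T}
    (h : ∀ i, C.inPort i = (v, t) → x i = x' i) : C.inputAt x v t = C.inputAt x' v t := by
  unfold inputAt
  split_ifs with hi
  · rw [h _ hi.choose_spec]
  · rfl

/-- The bits that are stored in a node or sent along a wire in one of the cycles. -/
abbrev Transfer : Type :=
  (Fin C.T × C.nodes × Fin m) ⊕ (Fin C.T × Fin C.numWires × Bool)

/-- The node that determines a transferred bit. -/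
def Transfer.sender {C : Circuit m k n} : C.Transfer → ℤ × ℤ
  | .inl b => b.2.1
  | .inr b => if b.2.2 then C.src b.2.1 else C.dst b.2.1

/-- The node that gets a transferred bit in the following cycle. -/
def Transfer.receiver {C : Circuit m k n} : C.Transfer → ℤ × ℤ
  | .inl b => b.2.1
  | .inr b => if b.2.2 then C.dst b.2.1 else C.src b.2.1

/-- The cycle in which a transferred bit is determined. -/
def Transfer.time {C : Circuit m k n} : C.Transfer → Fin C.T
  | .inl b => b.1
  | .inr b => b.1

/-- The value of a transferred bit. -/
noncomputable def Transfer.bit {C : Circuit m k n} (x : Fin k → Bool) : C.Transfer → Bool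
  | .inl b => (C.result x b.1 b.2.1).1 b.2.2
  | .inr b => (C.result x b.1 (if b.2.2 then C.src b.2.1 else C.dst b.2.1)).2.1 b.2.1

/-- Nodes outside a region of space-time do not notice a change of inputs inside it that does not
affect the bits leaving the region. -/
lemma result_congr {κ : Type*} (col : ℤ × ℤ → ℕ → κ) (P : κ) {x x' : Fin k → Bool}
    (hx : ∀ i, col (C.inPort i).1 (C.inPort i).2 ≠ P → x i = x' i)
    (hb : ∀ b : C.Transfer, col b.sender b.time = P → col b.receiver (b.time + 1) ≠ P →
      Transfer.bit x b = Transfer.bit x' b) :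
    ∀ (t : ℕ) (ht : t < C.T), ∀ v ∈ C.nodes, col v t ≠ P →
      C.result x ⟨t, ht⟩ v = C.result x' ⟨t, ht⟩ v := by
  intro t
  induction t with
  | zero =>
    intro ht v hv hP
    have hin := C.inputAt_congr (x := x) (x' := x') (v := v) (t := ⟨0, ht⟩)
      (fun i hi => hx i (by rw [hi]; exact hP))
    simp only [result, nodeResult, hin, configAt]
  | succ t ih =>
    intro ht v hv hP
    have ht' : t < C.T := by omega
    have hin := C.inputAt_congr (x := x) (x' := x') (v := v) (t := ⟨t + 1, ht⟩)
      (fun i hi => hx i (by rw [hi]; exact hP))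
    have hmem : (C.configAt x (t + 1)).mem v = (C.configAt x' (t + 1)).mem v := by
      rw [C.configAt_succ x t ht', C.configAt_succ x' t ht']
      change (C.result x ⟨t, ht'⟩ v).1 = (C.result x' ⟨t, ht'⟩ v).1
      -- The bit kept in memory either comes from inside the region, where `hb` applies, or from
      -- outside, where the induction hypothesis does. The bits on wires are treated in the same
      -- way.
      by_cases hvt : col v t = P
      · funext a
        exact hb (.inl (⟨t, ht'⟩, ⟨v, hv⟩, a)) hvt hP
      · rw [ih ht' v hv hvt]
    have harr : C.arriving (C.configAt x (t + 1)) v = C.arriving (C.configAt x' (t + 1)) v := by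
      funext w
      rw [C.configAt_succ x t ht', C.configAt_succ x' t ht']
      unfold arriving
      split_ifs with h1 h2
      · change (C.result x ⟨t, ht'⟩ (C.src w)).2.1 w = (C.result x' ⟨t, ht'⟩ (C.src w)).2.1 w
        by_cases hvt : col (C.src w) t = P
        · exact hb (.inr (⟨t, ht'⟩, w, true)) hvt (by
            change col (C.dst w) (t + 1) ≠ P
            rwa [h1])
        · rw [ih ht' _ (C.src_mem w) hvt]
      · change (C.result x ⟨t, ht'⟩ (C.dst w)).2.1 w = (C.result x' ⟨t, ht'⟩ (C.dst w)).2.1 w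
        by_cases hvt : col (C.dst w) t = P
        · exact hb (.inr (⟨t, ht'⟩, w, false)) hvt (by
            change col (C.src w) (t + 1) ≠ P
            rwa [h2])
        · rw [ih ht' _ (C.dst_mem w) hvt]
      · rfl
    simp only [result, nodeResult, hin, hmem, harr]

/-- Memory stays in place, so it crosses only when `φ` changes; a bit on a wire crosses only then or
if the wire is cut by `χ`. The factor `m + 8` counts `m` bits for each of at most `A` nodes and two
bits for each of at most `4 * A` wires. -/
lemma card_crossing_transfers_le {χ : ℤ × ℤ → ℕ} {φ : ℕ → ℕ} (hφ : Monotone φ) :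
    (Finset.univ.filter fun b : C.Transfer =>
      (χ b.sender, φ b.time) ≠ (χ b.receiver, φ (b.time + 1))).card ≤
      φ C.T * ((m + 8) * C.area) + 2 * C.T * (bichromatic C.occupied χ).card := by
  classical
  set Ch := Finset.univ.filter fun t : Fin C.T => φ t ≠ φ (t + 1) with hCh
  set W := Finset.univ.filter fun w => χ (C.src w) ≠ χ (C.dst w) with hW
  have hsub : (Finset.univ.filter fun b : C.Transfer =>
      (χ b.sender, φ b.time) ≠ (χ b.receiver, φ (b.time + 1))) ⊆
      (Ch ×ˢ (Finset.univ : Finset (C.nodes × Fin m))).disjSum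
        ((Ch ×ˢ (Finset.univ : Finset (Fin C.numWires × Bool))) ∪
          (Finset.univ : Finset (Fin C.T)) ×ˢ (W ×ˢ (Finset.univ : Finset Bool))) := by
    rintro (⟨t, v, a⟩ | ⟨t, w, d⟩) hb
    · simpa [hCh, Transfer.sender, Transfer.receiver, Transfer.time] using hb
    · have h1 : φ t ≠ φ (t + 1) ∨ χ (C.src w) ≠ χ (C.dst w) := by
        by_contra! h
        cases d <;> simp [Transfer.sender, Transfer.receiver, Transfer.time, h.1, h.2] at hb
      simpa [hCh, hW] using h1
  have h1 : Ch.card ≤ φ C.T := card_changes_le hφ C.T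
  have h2 : W.card ≤ (bichromatic C.occupied χ).card := C.card_bichromatic_wires_le χ
  have h3 := C.card_nodes_le
  have h4 := C.numWires_le
  calc _ ≤ _ := Finset.card_le_card hsub
    _ ≤ Ch.card * (C.nodes.card * m) + (Ch.card * (C.numWires * 2) + C.T * (W.card * 2)) := by
      rw [Finset.card_disjSum]
      refine Nat.add_le_add (le_of_eq ?_) ((Finset.card_union_le _ _).trans (le_of_eq ?_)) <;>
        simp [Finset.card_product]
    _ = Ch.card * (C.nodes.card * m + C.numWires * 2) + 2 * C.T * W.card := by ring
    _ ≤ φ C.T * ((m + 8) * C.area) + 2 * C.T * (bichromatic C.occupied χ).card := by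
      refine Nat.add_le_add (Nat.mul_le_mul h1 ?_) (Nat.mul_le_mul_left _ h2)
      nlinarith [Nat.mul_le_mul_right m h3]

/-- Cut space according to `χ` and time according to `φ`. If none of the pieces produces more than
`p` output bits and the error probability is less than `ε ^ p / 2`, then the pieces have to
communicate `k` bits in total. -/
theorem card_input_le {ε : ℝ} (h0 : 0 ≤ ε) (h1 : ε ≤ 1)
    {dec : (Fin n → Option Bool) → (Fin k → Bool)} (χ : ℤ × ℤ → ℕ) {φ : ℕ → ℕ}
    (hφ : Monotone φ) {p : ℕ}
    (hp : ∀ a b, (Finset.univ.filter fun i =>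
      χ (C.outPort i).1 = a ∧ φ (C.outPort i).2 = b).card ≤ p)
    (hPe : blockErrorProb ε C.compute dec < 1 / 2 * ε ^ p) :
    k ≤ φ C.T * ((m + 8) * C.area) + 2 * C.T * (bichromatic C.occupied χ).card := by
  refine le_trans ?_ (C.card_crossing_transfers_le hφ)
  refine card_le_card_crossing h0 h1 (enc := C.compute) (dec := dec)
    (fun b : C.Transfer => (χ b.sender, φ b.time)) (fun b => (χ b.receiver, φ (b.time + 1)))
    Transfer.bit (fun i => (χ (C.inPort i).1, φ (C.inPort i).2))
    (fun i => (χ (C.outPort i).1, φ (C.outPort i).2)) ?_ (p := p) ?_ hPe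
  · intro P x x' hx hb j hj
    rw [compute_apply, compute_apply]
    rw [C.result_congr (fun v t => (χ v, φ t)) P hx hb _ _ _ (C.outPort_mem j) hj]
  · rintro ⟨a, b⟩
    simpa using hp a b

/-! ## Elementary bounds on area and time -/

lemma outputNodes_subset : C.outputNodes ⊆ C.nodes := by
  intro v hv
  obtain ⟨i, -, rfl⟩ := Finset.mem_image.1 hv
  exact C.outPort_mem i

lemma card_outputNodes_le : C.outputNodes.card ≤ C.area :=
  (Finset.card_le_card C.outputNodes_subset).trans C.card_nodes_le

lemma outPort_fst_mem (i : Fin n) : (C.outPort i).1 ∈ C.outputNodes :=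
  Finset.mem_image_of_mem _ (Finset.mem_univ i)

lemma le_card_outputNodes_mul : n ≤ C.outputNodes.card * C.T := by
  have := Finset.card_le_card_of_injOn (s := (Finset.univ : Finset (Fin n)))
    (t := C.outputNodes ×ˢ (Finset.univ : Finset (Fin C.T))) C.outPort
    (fun i _ => by simp [C.outPort_fst_mem i]) C.outPort_injective.injOn
  simpa [Finset.card_product] using this

lemma length_le_energy : n ≤ C.energy :=
  C.le_card_outputNodes_mul.trans (Nat.mul_le_mul_right _ C.card_outputNodes_le)

lemma one_le_T (hn : 0 < n) : 1 ≤ C.T :=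
  Nat.succ_le_of_lt ((Nat.zero_le _).trans_lt (C.outPort ⟨0, hn⟩).2.2)

lemma FullyParallel.card_outputNodes {C : Circuit m k n} (h : C.FullyParallel) :
    C.outputNodes.card = n := by
  rw [outputNodes, Finset.card_image_of_injective _ h.2]
  simp

end Circuit

/-! ## The number of erasures that has to be tolerated -/

/-- Rounding a number that is at least 1 down to an integer loses at most a factor of 2. -/
lemma exists_root (r : ℕ) (hr : r ≠ 0) (p : ℕ) (hp : 1 ≤ p) :
    ∃ q : ℕ, 1 ≤ q ∧ q ^ r ≤ p ∧ (p : ℝ) ^ (1 / r : ℝ) ≤ 2 * q := by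
  have hx : (1 : ℝ) ≤ (p : ℝ) ^ (1 / r : ℝ) :=
    Real.one_le_rpow (by exact_mod_cast hp) (by positivity)
  have h1 : 1 ≤ ⌊(p : ℝ) ^ (1 / r : ℝ)⌋₊ := Nat.le_floor (by simpa using hx)
  refine ⟨⌊(p : ℝ) ^ (1 / r : ℝ)⌋₊, h1, ?_, ?_⟩
  · have h2 : (⌊(p : ℝ) ^ (1 / r : ℝ)⌋₊ : ℝ) ^ r ≤ ((p : ℝ) ^ (1 / r : ℝ)) ^ r :=
      pow_le_pow_left₀ (by positivity) (Nat.floor_le (by positivity)) _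
    have h3 : ((p : ℝ) ^ (1 / r : ℝ)) ^ r = p := by
      rw [one_div, Real.rpow_inv_natCast_pow (by positivity) hr]
    rw [h3] at h2
    exact_mod_cast h2
  · have h3 := Nat.lt_floor_add_one ((p : ℝ) ^ (1 / r : ℝ))
    have h4 : (1 : ℝ) ≤ ⌊(p : ℝ) ^ (1 / r : ℝ)⌋₊ := by exact_mod_cast h1
    linarith

lemma exists_number_of_erasures {ε : ℝ} (h0 : 0 < ε) (h1 : ε < 1) :
    ∃ κ : ℝ, 0 < κ ∧ ∃ L₀ : ℝ, 0 < L₀ ∧ ∀ L, L₀ ≤ L →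
      ∃ p : ℕ, 1 ≤ p ∧ κ * L ≤ p ∧ Real.exp (-L) < 1 / 2 * ε ^ p := by
  have hl : 0 < -Real.log ε := neg_pos.2 (Real.log_neg h0 h1)
  set l := -Real.log ε with hl'
  have h3 : 0 < Real.log 3 := Real.log_pos (by norm_num)
  -- The exponent is `p = ⌊(L - log 3) / l⌋`. The 3 makes `ε ^ p ≥ 3 * exp (-L)`, strictly more than
  -- the required `2 * exp (-L)`; the threshold on `L` keeps `p ≥ 1` and lets `L / (2 * l)` absorb
  -- `log 3` and the rounding.
  refine ⟨1 / (2 * l), by positivity, 2 * (Real.log 3 + l), by positivity, fun L hL => ?_⟩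
  have hx : 1 ≤ (L - Real.log 3) / l := by
    rw [le_div_iff₀ hl]
    linarith
  refine ⟨⌊(L - Real.log 3) / l⌋₊, Nat.le_floor (by simpa using hx), ?_, ?_⟩
  · have h4 := Nat.lt_floor_add_one ((L - Real.log 3) / l)
    refine le_trans ?_ (by linarith : (L - Real.log 3) / l - 1 ≤ _)
    rw [← sub_nonneg]
    have : (L - Real.log 3) / l - 1 - 1 / (2 * l) * L = (L / 2 - (Real.log 3 + l)) / l := by
      field_simp
      ring
    rw [this]
    exact div_nonneg (by linarith) hl.le
  · have h4 := Nat.floor_le (by linarith : 0 ≤ (L - Real.log 3) / l)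
    rw [le_div_iff₀ hl] at h4
    have h5 : ε ^ ⌊(L - Real.log 3) / l⌋₊ = Real.exp (-(⌊(L - Real.log 3) / l⌋₊ * l)) := by
      rw [hl', mul_neg, neg_neg, Real.exp_nat_mul, Real.exp_log h0]
    have h6 : 3 * Real.exp (-L) ≤ ε ^ ⌊(L - Real.log 3) / l⌋₊ := by
      rw [h5]
      calc 3 * Real.exp (-L) = Real.exp (Real.log 3 + -L) := by
            rw [Real.exp_add, Real.exp_log (by norm_num)]
        _ ≤ _ := Real.exp_le_exp.2 (by linarith)
    linarith [Real.exp_pos (-L)]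

lemma exists_number_of_erasures_pow {ε : ℝ} (h0 : 0 < ε) (h1 : ε < 1) (r : ℕ) (hr : r ≠ 0) :
    ∃ κ : ℝ, 0 < κ ∧ ∃ L₀ : ℝ, 0 < L₀ ∧ ∀ L, L₀ ≤ L →
      ∃ q : ℕ, 1 ≤ q ∧ κ * L ^ (1 / r : ℝ) ≤ q ∧ Real.exp (-L) < 1 / 2 * ε ^ (q ^ r) := by
  obtain ⟨κ, hκ, L₀, hL₀, h⟩ := exists_number_of_erasures h0 h1
  refine ⟨κ ^ (1 / r : ℝ) / 2, by positivity, L₀, hL₀, fun L hL => ?_⟩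
  obtain ⟨p, hp, hpL, hpe⟩ := h L hL
  obtain ⟨q, hq, hqp, hpq⟩ := exists_root r hr p hp
  refine ⟨q, hq, ?_, hpe.trans_le ?_⟩
  · have h2 := Real.rpow_le_rpow (mul_nonneg hκ.le (hL₀.le.trans hL)) hpL
      (by positivity : (0 : ℝ) ≤ 1 / r)
    rw [Real.mul_rpow hκ.le (hL₀.le.trans hL)] at h2
    linarith
  · have := pow_le_pow_of_le_one h0.le h1.le hqp
    linarith

namespace Circuit

/-! ## Energy bounds for a single circuit -/

/-- For bounded `L`, a bound by `n L ^ r` follows from `E ≥ n`. -/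
lemma length_mul_rpow_le {m k n : ℕ} (C : Circuit m k n) {L L₀ r c : ℝ} (hL : 0 ≤ L) (hL' : L ≤ L₀)
    (hr : 0 ≤ r) (hc : 0 ≤ c) (hc' : c * L₀ ^ r ≤ 1) : c * (n * L ^ r) ≤ C.energy := by
  have h1 : (n : ℝ) ≤ C.energy := by exact_mod_cast C.length_le_energy
  have h2 := Real.rpow_le_rpow hL hL' hr
  have h3 : c * L ^ r ≤ 1 := (mul_le_mul_of_nonneg_left h2 hc).trans hc'
  calc c * (n * L ^ r) = n * (c * L ^ r) := by ring
    _ ≤ n * 1 := mul_le_mul_of_nonneg_left h3 (Nat.cast_nonneg _)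
    _ ≤ _ := by linarith

lemma blockErrorProb_lt_exp {ε f : ℝ} (h0 : 0 ≤ ε) (h1 : ε ≤ 1) {k n : ℕ}
    {enc : (Fin k → Bool) → (Fin n → Bool)} {dec : (Fin n → Option Bool) → (Fin k → Bool)}
    (hf : blockErrorProb ε enc dec < f) :
    blockErrorProb ε enc dec < Real.exp (-(-Real.log f)) := by
  rwa [neg_neg, Real.exp_log ((blockErrorProb_nonneg h0 h1 enc dec).trans_lt hf)]

lemma neg_log_nonneg {ε f : ℝ} (h0 : 0 ≤ ε) (h1 : ε ≤ 1) {k n : ℕ}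
    {enc : (Fin k → Bool) → (Fin n → Bool)} {dec : (Fin n → Option Bool) → (Fin k → Bool)}
    (hf : blockErrorProb ε enc dec < f) (hf1 : f ≤ 1) : 0 ≤ -Real.log f :=
  neg_nonneg.2 (Real.log_nonpos ((blockErrorProb_nonneg h0 h1 enc dec).trans hf.le) hf1)

lemma FullyParallel.card_outputs_le {m k n : ℕ} {C : Circuit m k n} (hC : C.FullyParallel)
    (χ : ℤ × ℤ → ℕ) (a p : ℕ) (h : (C.outputNodes.filter fun o => χ o = a).card ≤ p) :
    (Finset.univ.filter fun i => χ (C.outPort i).1 = a).card ≤ p := by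
  refine le_trans (Finset.card_le_card_of_injOn (fun i => (C.outPort i).1) (fun i hi => ?_)
    hC.2.injOn) h
  simpa [C.outPort_fst_mem i] using hi

lemma card_outputs_le {m k n : ℕ} (C : Circuit m k n)
    (χ : ℤ × ℤ → ℕ) (a b p w : ℕ) (hw : 0 < w)
    (h : (C.outputNodes.filter fun o => χ o = a).card ≤ p) :
    (Finset.univ.filter fun i => χ (C.outPort i).1 = a ∧ ((C.outPort i).2 : ℕ) / w = b).card ≤
      p * w := by
  have h1 := Finset.card_le_card_of_injOn
    (s := Finset.univ.filter fun i => χ (C.outPort i).1 = a ∧ ((C.outPort i).2 : ℕ) / w = b)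
    (t := (C.outputNodes.filter fun o => χ o = a) ×ˢ Finset.Ico (b * w) (b * w + w))
    (fun i => ((C.outPort i).1, ((C.outPort i).2 : ℕ))) (by
      intro i hi
      obtain ⟨h2, h3⟩ : χ (C.outPort i).1 = a ∧ ((C.outPort i).2 : ℕ) / w = b := by simpa using hi
      rw [Nat.div_eq_iff hw] at h3
      simp only [Finset.coe_product, Set.mem_prod, Finset.mem_coe, Finset.mem_filter,
        C.outPort_fst_mem i, h2, Finset.mem_Ico, true_and]
      omega) (by
      intro i _ i' _ hii
      simp only [Prod.mk.injEq] at hii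
      exact C.outPort_injective (Prod.ext hii.1 (Fin.ext hii.2)))
  refine h1.trans ?_
  rw [Finset.card_product, Nat.card_Ico, Nat.add_sub_cancel_left]
  exact Nat.mul_le_mul_right _ h

/-- An output node of a fully-parallel circuit produces a single bit, so cutting space alone limits
the outputs per class. Memory never crosses such a cut, which is why the constant is independent of
`m`. -/
theorem FullyParallel.exists_le_energy_mul {ε : ℝ} (h0 : 0 < ε) (h1 : ε < 1) {R : ℝ} (hR : 0 < R) :
    ∃ c : ℝ, 0 < c ∧ ∀ {m k n : ℕ} (C : Circuit m k n) (dec : (Fin n → Option Bool) → (Fin k → Bool))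
      (f : ℝ), C.FullyParallel → 0 < n → R / 2 * n ≤ k → blockErrorProb ε C.compute dec < f → f ≤ 1 →
      c * (n * (-Real.log f)) ≤ C.energy * C.T := by
  obtain ⟨κ, hκ, L₀, hL₀, h⟩ := exists_number_of_erasures h0 h1
  refine ⟨min (1 / L₀) (κ * R ^ 2 / 102400), by positivity, ?_⟩
  intro m k n C dec f hC hn hk hPe hf
  have hL := neg_log_nonneg h0.le h1.le hPe hf
  have hPe' := blockErrorProb_lt_exp h0.le h1.le hPe
  set L := -Real.log f
  have hn' : (0 : ℝ) < n := by exact_mod_cast hn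
  have hT : (1 : ℝ) ≤ C.T := by exact_mod_cast C.one_le_T hn
  rcases le_total L L₀ with hLL | hLL
  · have h2 := C.length_mul_rpow_le (r := 1) (c := min (1 / L₀) (κ * R ^ 2 / 102400)) hL hLL zero_le_one
      (by positivity) (by
        rw [Real.rpow_one]
        refine (mul_le_mul_of_nonneg_right (min_le_left _ _) hL₀.le).trans (le_of_eq ?_)
        field_simp)
    rw [Real.rpow_one] at h2
    exact h2.trans (le_mul_of_one_le_right (Nat.cast_nonneg _) hT)
  · obtain ⟨p, hp, hpL, hpe⟩ := h L hLL
    obtain ⟨χ, hχ, hcut⟩ := exists_partition C.occupied C.outputNodes p hp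
    have h2 := C.card_input_le h0.le h1.le (dec := dec) χ (φ := fun _ => 0) monotone_const (p := p)
      (fun a b => (Finset.card_le_card (fun i hi => by
        simp only [Finset.mem_filter] at hi ⊢
        exact ⟨hi.1, hi.2.1⟩)).trans (hC.card_outputs_le χ a p (by convert hχ a)))
      (hPe'.trans hpe)
    rw [zero_mul, zero_add] at h2
    rw [C.card_occupied, hC.card_outputNodes] at hcut
    have hp' : (0 : ℝ) < p := by exact_mod_cast hp
    have h3 : R / 2 * n ≤ 160 * C.T * Real.sqrt (C.area * n / p) := by
      refine hk.trans ?_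
      calc (k : ℝ) ≤ 2 * C.T * (bichromatic C.occupied χ).card := by exact_mod_cast h2
        _ ≤ 2 * C.T * (80 * Real.sqrt (C.area * n / p)) :=
          mul_le_mul_of_nonneg_left hcut (by positivity)
        _ = _ := by ring
    have h4 := pow_le_pow_left₀ (by positivity) h3 2
    rw [mul_pow _ (Real.sqrt _), Real.sq_sqrt (by positivity), mul_div_assoc', le_div_iff₀ hp'] at h4
    -- Squaring `R * n / 2 ≤ 160 * T * √(A * n / p)` yields `102400 = 4 * 160 ^ 2`.
    have h5 : R ^ 2 * p * n ≤ 102400 * (C.area * C.T * C.T) := by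
      refine le_of_mul_le_mul_right ?_ hn'
      nlinarith
    calc min (1 / L₀) (κ * R ^ 2 / 102400) * (n * L) ≤ κ * R ^ 2 / 102400 * (n * L) :=
          mul_le_mul_of_nonneg_right (min_le_right _ _) (by positivity)
      _ = R ^ 2 * (κ * L) * n / 102400 := by ring
      _ ≤ R ^ 2 * p * n / 102400 := by gcongr
      _ ≤ C.area * C.T * C.T := by linarith
      _ = _ := by simp [energy]

theorem exists_le_energy_of_serial {ε : ℝ} (h0 : 0 < ε) (h1 : ε < 1) {R : ℝ} (hR : 0 < R) (m j : ℕ) :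
    ∃ c : ℝ, 0 < c ∧ ∀ {k n : ℕ} (C : Circuit m k n) (dec : (Fin n → Option Bool) → (Fin k → Bool))
      (f : ℝ), C.outputNodes.card = j → 0 < n → R / 2 * n ≤ k →
      blockErrorProb ε C.compute dec < f → f ≤ 1 → c * (n * (-Real.log f)) ≤ C.energy := by
  obtain ⟨κ, hκ, L₀, hL₀, h⟩ := exists_number_of_erasures h0 h1
  -- Beyond `j / κ` one has `p ≥ κ * L ≥ j`, so windows of `p / j` cycles are nonempty. Smaller `L`
  -- are covered by `E ≥ n`.
  set c := min (1 / max L₀ (j / κ)) (κ * R / (4 * (m + 8) * (j + 1))) with hc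
  have hM : 0 < max L₀ (j / κ) := hL₀.trans_le (le_max_left _ _)
  refine ⟨c, by positivity, ?_⟩
  intro k n C dec f hC hn hk hPe hf
  have hL := neg_log_nonneg h0.le h1.le hPe hf
  have hPe' := blockErrorProb_lt_exp h0.le h1.le hPe
  set L := -Real.log f
  rcases le_total L (max L₀ (j / κ)) with hLL | hLL
  · have h2 := C.length_mul_rpow_le (r := 1) (c := c) hL hLL zero_le_one
      (by positivity) (by
        rw [Real.rpow_one]
        refine (mul_le_mul_of_nonneg_right (min_le_left _ _) hM.le).trans (le_of_eq ?_)
        field_simp)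
    rwa [Real.rpow_one] at h2
  · obtain ⟨p, hp, hpL, hpe⟩ := h L ((le_max_left _ _).trans hLL)
    have hj : 0 < j := by
      rw [← hC]
      exact Finset.card_pos.2 ⟨_, C.outPort_fst_mem ⟨0, hn⟩⟩
    have hjp : j ≤ p := by
      have h2 := (le_max_right _ _).trans hLL
      rw [div_le_iff₀ hκ] at h2
      exact_mod_cast (show (j : ℝ) ≤ p by linarith)
    have hw : 0 < p / j := Nat.div_pos hjp hj
    -- One spatial class: `j` nodes produce at most `j * (p / j) ≤ p` bits in each window.
    have h2 := C.card_input_le h0.le h1.le (dec := dec) (fun _ => 0) (φ := fun t => t / (p / j))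
      (fun _ _ hab => Nat.div_le_div_right hab) (p := p)
      (fun a b => (C.card_outputs_le (fun _ => 0) a b j _ hw
        ((Finset.card_filter_le _ _).trans hC.le)).trans (Nat.mul_div_le _ _))
      (hPe'.trans hpe)
    have h3 : bichromatic C.occupied (fun _ => 0) = ∅ := by simp [bichromatic]
    rw [h3, Finset.card_empty, mul_zero, add_zero] at h2
    have h4 : (p : ℝ) ≤ 2 * (p / j : ℕ) * j := by
      have h5 := Nat.lt_mul_div_succ p hj
      have : p ≤ 2 * (p / j) * j := by nlinarith
      exact_mod_cast this
    have h5 : (k : ℝ) * (p / j : ℕ) ≤ (m + 8) * C.energy := by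
      have : k * (p / j) ≤ (m + 8) * C.energy := by
        calc k * (p / j) ≤ C.T / (p / j) * ((m + 8) * C.area) * (p / j) := Nat.mul_le_mul_right _ h2
          _ = C.T / (p / j) * (p / j) * ((m + 8) * C.area) := by ring
          _ ≤ C.T * ((m + 8) * C.area) := Nat.mul_le_mul_right _ (Nat.div_mul_le_self _ _)
          _ = _ := by rw [energy]; ring
      exact_mod_cast this
    have h6 : R / 2 * n * (p / j : ℕ) ≤ (m + 8) * C.energy :=
      (mul_le_mul_of_nonneg_right hk (Nat.cast_nonneg _)).trans h5
    calc c * (n * L) ≤ κ * R / (4 * (m + 8) * (j + 1)) * (n * L) :=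
          mul_le_mul_of_nonneg_right (min_le_right _ _) (by positivity)
      _ = R * n * (κ * L) / (4 * (m + 8) * (j + 1)) := by ring
      _ ≤ R * n * (2 * (p / j : ℕ) * (j + 1)) / (4 * (m + 8) * (j + 1)) := by
        refine div_le_div_of_nonneg_right (mul_le_mul_of_nonneg_left (hpL.trans (h4.trans ?_))
          (by positivity)) (by positivity)
        exact mul_le_mul_of_nonneg_left (by linarith) (by positivity)
      _ = R / 2 * n * (p / j : ℕ) / (m + 8) := by
        field_simp
        ring
      _ ≤ _ := by
        rw [div_le_iff₀ (by positivity)]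
        linarith

theorem exists_le_energy {ε : ℝ} (h0 : 0 < ε) (h1 : ε < 1) {R : ℝ} (hR : 0 < R) (m : ℕ) :
    ∃ c : ℝ, 0 < c ∧ ∀ {k n : ℕ} (C : Circuit m k n) (dec : (Fin n → Option Bool) → (Fin k → Bool))
      (f : ℝ), R / 2 * n ≤ k →
      blockErrorProb ε C.compute dec < f → f ≤ 1 →
      c * (n * (-Real.log f) ^ (1 / 5 : ℝ)) ≤ C.energy := by
  obtain ⟨κ, hκ, L₀, hL₀, h⟩ := exists_number_of_erasures_pow h0 h1 5 (by norm_num)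
  -- Each of the two energy terms, with coefficients `m + 8` and 160, is allotted one half of `R /
  -- 2`.
  set d := min (R / (4 * (m + 8))) (R / 640) with hd
  set c := min (1 / L₀ ^ (1 / 5 : ℝ)) (κ * d) with hc
  have hd0 : 0 < d := by positivity
  refine ⟨c, by positivity, ?_⟩
  intro k n C dec f hk hPe hf
  have hL := neg_log_nonneg h0.le h1.le hPe hf
  have hPe' := blockErrorProb_lt_exp h0.le h1.le hPe
  set L := -Real.log f
  rcases le_total L L₀ with hLL | hLL
  · refine C.length_mul_rpow_le hL hLL (by norm_num) (by positivity) ?_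
    refine (mul_le_mul_of_nonneg_right (min_le_left _ _) (by positivity)).trans (le_of_eq ?_)
    field_simp
  · obtain ⟨q, hq, hqL, hqe⟩ := h L hLL
    norm_num only [Nat.cast_ofNat] at hqL
    obtain ⟨χ, hχ, hcut⟩ := exists_partition C.occupied C.outputNodes (q ^ 2) (by positivity)
    have h2 := C.card_input_le h0.le h1.le (dec := dec) χ (φ := fun t => t / q ^ 3)
      (fun _ _ hab => Nat.div_le_div_right hab) (p := q ^ 5)
      (fun a b => (C.card_outputs_le χ a b (q ^ 2) (q ^ 3) (by positivity)
        (by convert hχ a)).trans (by rw [← pow_add]))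
      (hPe'.trans hqe)
    have hq' : (1 : ℝ) ≤ q := by exact_mod_cast hq
    have hA : (C.outputNodes.card : ℝ) ≤ C.area := by exact_mod_cast C.card_outputNodes_le
    -- Since there are at most `A` output nodes, the spatial cut has at most `80 * √(A * A / q ^ 2)
    -- = 80 * A / q` sides.
    have h3 : ((bichromatic C.occupied χ).card : ℝ) * q ≤ 80 * C.area := by
      have h4 : Real.sqrt (C.area * C.outputNodes.card / (q ^ 2 : ℕ)) ≤ C.area / q := by
        refine Real.sqrt_le_iff.2 ⟨by positivity, ?_⟩
        rw [div_pow, pow_two (C.area : ℝ)]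
        push_cast
        gcongr
      rw [C.card_occupied] at hcut
      have h5 := hcut.trans (mul_le_mul_of_nonneg_left h4 (by norm_num))
      rwa [mul_div_assoc', le_div_iff₀ (by linarith)] at h5
    -- To match the gain of the spatial cut, only a factor `q` of the window length is needed.
    have h4 : ((C.T / q ^ 3 : ℕ) : ℝ) * q ≤ C.T := by
      have : C.T / q ^ 3 * q ≤ C.T :=
        (Nat.mul_le_mul_left _ (Nat.le_self_pow (by norm_num) q)).trans (Nat.div_mul_le_self _ _)
      exact_mod_cast this
    have h5 : (k : ℝ) ≤ (C.T / q ^ 3 : ℕ) * ((m + 8) * C.area) +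
        2 * C.T * (bichromatic C.occupied χ).card := by exact_mod_cast h2
    have h6 : R / 2 * n * q ≤ (m + 8) * C.energy + 160 * C.energy := by
      calc R / 2 * n * q ≤ k * q := by gcongr
        _ ≤ ((C.T / q ^ 3 : ℕ) * ((m + 8) * C.area) +
            2 * C.T * (bichromatic C.occupied χ).card) * q := by gcongr
        _ = ((C.T / q ^ 3 : ℕ) * q) * ((m + 8) * C.area) +
            2 * C.T * ((bichromatic C.occupied χ).card * q) := by ring
        _ ≤ C.T * ((m + 8) * C.area) + 2 * C.T * (80 * C.area) := by gcongr
        _ = _ := by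
          simp only [energy, Nat.cast_mul]
          ring
    have h7 : d * (n * q) ≤ C.energy := by
      have e1 : d * (n * q) * (m + 8) ≤ R / 4 * (n * q) := by
        have : d * (m + 8) ≤ R / 4 := by
          refine (mul_le_mul_of_nonneg_right (min_le_left _ _) (by positivity)).trans (le_of_eq ?_)
          field_simp
        calc _ = d * (m + 8) * (n * q) := by ring
          _ ≤ _ := by gcongr
      have e2 : d * (n * q) * 160 ≤ R / 4 * (n * q) := by
        have : d * 160 ≤ R / 4 := by
          have := min_le_right (R / (4 * (m + 8))) (R / 640)
          linarith
        calc _ = d * 160 * (n * q) := by ring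
          _ ≤ _ := by gcongr
      have e3 : d * (n * q) * (m + 8 + 160) ≤ C.energy * (m + 8 + 160) := by linarith
      exact le_of_mul_le_mul_right e3 (by positivity)
    calc c * (n * L ^ (1 / 5 : ℝ)) ≤ κ * d * (n * L ^ (1 / 5 : ℝ)) :=
          mul_le_mul_of_nonneg_right (min_le_right _ _) (by positivity)
      _ = d * (n * (κ * L ^ (1 / 5 : ℝ))) := by ring
      _ ≤ d * (n * q) := by gcongr
      _ ≤ _ := h7

end Circuit

/-! ## Bit-meters circuits -/

/-- At most `|x - y|` of the shifts of the partition of `ℤ` into intervals of length `s`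
separate `x` and `y`. -/
lemma card_separating_shifts_le (x y : ℤ) (s : ℕ) (hs : 0 < s) :
    ((Finset.range s).filter fun a : ℕ => (x + a) / (s : ℤ) ≠ (y + a) / (s : ℤ)).card ≤
      (x - y).natAbs := by
  wlog hxy : x ≤ y generalizing x y with H
  · have h := H y x (by omega)
    rw [← Int.natAbs_neg, neg_sub]
    simpa only [ne_comm] using h
  have hs' : (0 : ℤ) < s := by exact_mod_cast hs
  -- A separating shift is charged to the left end of the interval containing `y`. This point lies
  -- in `(x, y]` and is congruent to `-a` modulo `s`, so different shifts have different points.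
  have h := Finset.card_le_card_of_injOn
    (s := (Finset.range s).filter fun a : ℕ => (x + a) / (s : ℤ) ≠ (y + a) / (s : ℤ))
    (t := Finset.Ioc x y) (fun a : ℕ => (y + a) / (s : ℤ) * s - a) (by
      intro a ha
      obtain ⟨-, ha⟩ : a < s ∧ (x + a) / (s : ℤ) ≠ (y + a) / (s : ℤ) := by simpa using ha
      have h1 : (x + a) / (s : ℤ) < (y + a) / (s : ℤ) :=
        lt_of_le_of_ne (Int.ediv_le_ediv hs' (by omega)) ha
      rw [Int.ediv_lt_iff_lt_mul hs'] at h1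
      have h2 := Int.ediv_mul_le (y + a) hs'.ne'
      simp only [Finset.coe_Ioc, Set.mem_Ioc]
      omega) (by
      intro a ha a' ha' haa
      have h1 : a < s := by
        have : a < s ∧ (x + a) / (s : ℤ) ≠ (y + a) / (s : ℤ) := by simpa using ha
        exact this.1
      have h2 : a' < s := by
        have : a' < s ∧ (x + a') / (s : ℤ) ≠ (y + a') / (s : ℤ) := by simpa using ha'
        exact this.1
      have h3 : (a : ℤ) ≡ a' [ZMOD s] := by
        rw [Int.modEq_iff_dvd]
        refine ⟨(y + a') / (s : ℤ) - (y + a) / (s : ℤ), ?_⟩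
        simp only at haa
        linear_combination haa
      have h4 := (Int.natCast_modEq_iff.1 h3)
      exact Nat.ModEq.eq_of_lt_of_lt h4 h1 h2)
  rw [Int.card_Ioc] at h
  omega

namespace BitMetersCircuit

variable {k n : ℕ} (C : BitMetersCircuit k n)

lemma bitsAt_succ (x : Fin k → Bool) (t : ℕ) (e : Fin C.numMsgs) : C.bitsAt x (t + 1) e =
    if (e : ℕ) = t then C.msg e (C.ownInputs x (C.src e)) (C.received (C.bitsAt x t) (C.src e))
    else C.bitsAt x t e := rfl

/-- A message is written once and never overwritten. -/
lemma bitsAt_eq_of_lt (x : Fin k → Bool) (e : Fin C.numMsgs) {t : ℕ} (ht : (e : ℕ) < t) :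
    C.bitsAt x t e = C.bitsAt x (e + 1) e := by
  induction t, Nat.succ_le_of_lt ht using Nat.le_induction with
  | base => rfl
  | succ t h ih =>
    rw [C.bitsAt_succ, if_neg (by omega), ih (by omega)]

lemma ownInputs_congr {x x' : Fin k → Bool} {v : Fin 3 → ℤ} (h : ∀ i, C.inNode i = v → x i = x' i) :
    C.ownInputs x v = C.ownInputs x' v := by
  funext i
  unfold ownInputs
  split_ifs with hi
  · exact h i hi
  · rfl

lemma received_congr {b b' : Fin C.numMsgs → Bool} {v : Fin 3 → ℤ}
    (h : ∀ e, C.dst e = v → b e = b' e) : C.received b v = C.received b' v := by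
  funext e
  unfold received
  split_ifs with he
  · exact h e he
  · rfl

/-- Nodes outside a region do not notice a change of inputs inside it that does not affect the
messages leaving the region. -/
lemma compute_congr (U : Set (Fin 3 → ℤ)) {x x' : Fin k → Bool}
    (hx : ∀ i, C.inNode i ∉ U → x i = x' i)
    (hb : ∀ e, C.src e ∈ U → C.dst e ∉ U → C.bitsAt x C.numMsgs e = C.bitsAt x' C.numMsgs e)
    (j : Fin n) (hj : C.outNode j ∉ U) : C.compute x j = C.compute x' j := by
  have key : ∀ t e, C.dst e ∉ U → C.bitsAt x t e = C.bitsAt x' t e := by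
    intro t
    induction t with
    | zero => exact fun _ _ => rfl
    | succ t ih =>
      intro e he
      by_cases hs : C.src e ∈ U
      · by_cases het : (e : ℕ) < t + 1
        · have := hb e hs he
          rwa [C.bitsAt_eq_of_lt x e e.2, C.bitsAt_eq_of_lt x' e e.2, ← C.bitsAt_eq_of_lt x e het,
            ← C.bitsAt_eq_of_lt x' e het] at this
        · rw [bitsAt_succ, bitsAt_succ, if_neg (by omega), if_neg (by omega), ih e he]
      · rw [bitsAt_succ, bitsAt_succ, ih e he,
          C.ownInputs_congr (x := x) (x' := x') fun i hi => hx i (by rwa [hi]),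
          C.received_congr (b := C.bitsAt x t) (b' := C.bitsAt x' t)
            fun e' he' => ih e' (by rwa [he'])]
  unfold compute
  rw [C.ownInputs_congr (x := x) (x' := x') fun i hi => hx i (by rwa [hi]),
    C.received_congr (b := C.bitsAt x C.numMsgs) (b' := C.bitsAt x' C.numMsgs)
      fun e he => key _ e (by rwa [he])]

/-- The length of a message. -/
noncomputable def length (e : Fin C.numMsgs) : ℝ :=
  Real.sqrt (∑ a, ((C.src e a : ℝ) - (C.dst e a : ℝ)) ^ 2)

lemma bitMeters_eq : C.bitMeters = ∑ e, C.length e := rfl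

lemma natAbs_le_length (e : Fin C.numMsgs) (a : Fin 3) :
    ((C.src e a - C.dst e a).natAbs : ℝ) ≤ C.length e := by
  rw [Nat.cast_natAbs, Int.cast_abs, Int.cast_sub]
  refine Real.abs_le_sqrt ?_
  exact Finset.single_le_sum (f := fun a => ((C.src e a : ℝ) - (C.dst e a : ℝ)) ^ 2)
    (fun _ _ => sq_nonneg _) (Finset.mem_univ a)

/-- Cut space into cubes of side `s`: all cubes together emit at least `k` bits. -/
theorem side_mul_le_bitMeters {ε : ℝ} (h0 : 0 ≤ ε) (h1 : ε ≤ 1)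
    {dec : (Fin n → Option Bool) → (Fin k → Bool)} (s : ℕ) (hs : 0 < s)
    (hPe : blockErrorProb ε C.compute dec < 1 / 2 * ε ^ (s ^ 3)) :
    (s : ℝ) * k ≤ 3 * C.bitMeters := by
  -- The cubes are shifted by `a` in all three coordinates at once, so `s` shifts suffice for the
  -- averaging.
  let col : ℕ → (Fin 3 → ℤ) → (Fin 3 → ℤ) := fun a v i => (v i + a) / (s : ℤ)
  have hs' : (0 : ℤ) < s := by exact_mod_cast hs
  have hk : ∀ a, k ≤ (Finset.univ.filter fun e => col a (C.src e) ≠ col a (C.dst e)).card := by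
    intro a
    refine card_le_card_crossing h0 h1 (enc := C.compute) (dec := dec) (fun e => col a (C.src e))
      (fun e => col a (C.dst e)) (fun x e => C.bitsAt x C.numMsgs e) (fun i => col a (C.inNode i))
      (fun j => col a (C.outNode j)) ?_ (p := s ^ 3) ?_ hPe
    · intro P x x' hx hb j hj
      exact C.compute_congr {v | col a v = P} hx hb j hj
    · intro P
      have h := Finset.card_le_card_of_injOn
        (s := Finset.univ.filter fun j => col a (C.outNode j) = P)
        (t := Fintype.piFinset fun i => Finset.Ico (P i * s - a) (P i * s - a + s)) C.outNode (by
          intro j hj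
          obtain rfl : col a (C.outNode j) = P := by simpa using hj
          simp only [Finset.mem_coe, Fintype.mem_piFinset, Finset.mem_Ico, col]
          intro i
          have h2 := Int.ediv_mul_le (C.outNode j i + a) hs'.ne'
          have h3 := Int.lt_ediv_add_one_mul_self (C.outNode j i + a) hs'
          rw [add_mul, one_mul] at h3
          omega) C.outNode_injective.injOn
      refine h.trans (le_of_eq ?_)
      simp
  -- Double counting of (shift, crossing message): a crossing message is separated in some
  -- coordinate, and coordinate `i` accounts for at most `|src i - dst i|` shifts.
  have h2 : s * k ≤ ∑ e : Fin C.numMsgs, ∑ i : Fin 3, (C.src e i - C.dst e i).natAbs := by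
    calc s * k = ∑ a ∈ Finset.range s, k := by simp
      _ ≤ ∑ a ∈ Finset.range s,
          (Finset.univ.filter fun e => col a (C.src e) ≠ col a (C.dst e)).card :=
        Finset.sum_le_sum fun a _ => hk a
      _ = ∑ e : Fin C.numMsgs,
          ((Finset.range s).filter fun a => col a (C.src e) ≠ col a (C.dst e)).card := by
        simp_rw [Finset.card_filter]
        exact Finset.sum_comm
      _ ≤ _ := by
        refine Finset.sum_le_sum fun e _ => ?_
        refine le_trans (Finset.card_le_card (t := Finset.univ.biUnion fun i : Fin 3 =>
          (Finset.range s).filter fun a : ℕ =>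
            (C.src e i + a) / (s : ℤ) ≠ (C.dst e i + a) / (s : ℤ)) fun a ha => ?_)
          (Finset.card_biUnion_le.trans
            (Finset.sum_le_sum fun i _ => card_separating_shifts_le _ _ s hs))
        rw [Finset.mem_filter] at ha
        obtain ⟨i, hi⟩ := Function.ne_iff.1 ha.2
        exact Finset.mem_biUnion.2 ⟨i, Finset.mem_univ _, Finset.mem_filter.2 ⟨ha.1, hi⟩⟩
  calc (s : ℝ) * k ≤ ∑ e : Fin C.numMsgs, ∑ i : Fin 3, ((C.src e i - C.dst e i).natAbs : ℝ) := by
        exact_mod_cast h2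
    _ ≤ ∑ e : Fin C.numMsgs, ∑ i : Fin 3, C.length e :=
      Finset.sum_le_sum fun e _ => Finset.sum_le_sum fun i _ => C.natAbs_le_length e i
    _ = 3 * C.bitMeters := by
      rw [bitMeters_eq, Finset.mul_sum]
      simp

/-! ### Input bits that are never communicated -/

lemma one_le_length {e : Fin C.numMsgs} (h : C.src e ≠ C.dst e) : 1 ≤ C.length e := by
  obtain ⟨i, hi⟩ := Function.ne_iff.1 h
  refine le_trans ?_ (C.natAbs_le_length e i)
  have : 1 ≤ (C.src e i - C.dst e i).natAbs := by omega
  exact_mod_cast this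

open Classical in
/-- The input bits whose nodes do not send anything to another node. -/
noncomputable def silent : Finset (Fin k) :=
  Finset.univ.filter fun i => ∀ e, C.src e = C.inNode i → C.dst e = C.src e

/-- Every other input bit has a message leaving its node, of length at least 1; input nodes are
distinct, hence so are these messages. -/
lemma le_card_silent_add_bitMeters : (k : ℝ) ≤ C.silent.card + C.bitMeters := by
  classical
  have h : ∀ i : {i // i ∉ C.silent}, ∃ e, C.src e = C.inNode i ∧ C.dst e ≠ C.src e := by
    rintro ⟨i, hi⟩
    simpa [silent] using hi
  choose e he he' using h
  have hinj : Function.Injective e := fun i i' hii =>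
    Subtype.ext (C.inNode_injective ((he i).symm.trans (by rw [hii]; exact he i')))
  have h1 : ((Finset.univ : Finset {i // i ∉ C.silent}).card : ℝ) ≤ C.bitMeters := by
    calc ((Finset.univ : Finset {i // i ∉ C.silent}).card : ℝ)
        = ∑ i : {i // i ∉ C.silent}, (1 : ℝ) := by simp
      _ ≤ ∑ i, C.length (e i) := Finset.sum_le_sum fun i _ => C.one_le_length (he' i).symm
      _ = ∑ e' ∈ Finset.univ.map ⟨e, hinj⟩, C.length e' := by rw [Finset.sum_map]; rfl
      _ ≤ _ := Finset.sum_le_sum_of_subset_of_nonneg (Finset.subset_univ _)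
        fun _ _ _ => Real.sqrt_nonneg _
  have h2 : (Finset.univ : Finset {i // i ∉ C.silent}).card + C.silent.card = k := by
    have := Fintype.card_subtype_compl (fun i => i ∈ C.silent)
    have h3 := Finset.card_le_univ C.silent
    simp only [Fintype.card_coe, Fintype.card_fin] at this h3
    rw [Finset.card_univ]
    omega
  have h3 : ((Finset.univ : Finset {i // i ∉ C.silent}).card : ℝ) + C.silent.card = k := by
    exact_mod_cast h2
  linarith

/-- Input bits that are not sent anywhere are at best protected by a single output bit each. -/
lemma one_sub_blockErrorProb_le {ε : ℝ} (h0 : 0 ≤ ε) (h1 : ε ≤ 1)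
    (dec : (Fin n → Option Bool) → (Fin k → Bool)) :
    1 - blockErrorProb ε C.compute dec ≤ (1 - ε / 2) ^ C.silent.card := by
  classical
  let O : Finset (Fin n) := Finset.univ.filter fun j => ∃ i ∈ C.silent, C.outNode j = C.inNode i
  have hcard : O.card ≤ C.silent.card := by
    refine Finset.card_le_card_of_forall_subsingleton (fun j i => C.outNode j = C.inNode i)
      (fun j hj => (Finset.mem_filter.1 hj).2) fun i _ j hj j' hj' => ?_
    exact C.outNode_injective (hj.2.trans hj'.2.symm)
  have hE : ∀ E : Finset (Fin n), ((decodedCorrectly C.compute dec E).card : ℝ) / 2 ^ k ≤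
      2 ^ (O \ E).card * (1 / 2) ^ C.silent.card := by
    intro E
    -- The silent inputs whose node has no surviving output bit: nothing received depends on them,
    -- so they can only be guessed.
    let I : Finset (Fin k) := C.silent.filter fun i => ∀ j ∉ E, C.outNode j ≠ C.inNode i
    have hI : C.silent.card ≤ I.card + (O \ E).card := by
      have h2 : (C.silent.filter fun i => ¬ ∀ j ∉ E, C.outNode j ≠ C.inNode i).card ≤
          (O \ E).card := by
        refine Finset.card_le_card_of_forall_subsingleton (fun i j => C.outNode j = C.inNode i)
          (fun i hi => ?_) fun j _ i hi i' hi' => C.inNode_injective (hi.2.symm.trans hi'.2)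
        rw [Finset.mem_filter] at hi
        obtain ⟨his, hi⟩ := hi
        push Not at hi
        obtain ⟨j, hj, hji⟩ := hi
        exact ⟨j, Finset.mem_sdiff.2 ⟨Finset.mem_filter.2 ⟨Finset.mem_univ _, i, his, hji⟩, hj⟩, hji⟩
      have h3 := Finset.card_filter_add_card_filter_not (s := C.silent)
        (fun i => ∀ j ∉ E, C.outNode j ≠ C.inNode i)
      simp only [I]
      omega
    have h2 := card_decodedCorrectly_mul_le (E := E) (enc := C.compute) dec I (fun _ => ()) (by
      intro x x' hx _
      funext j
      unfold erase
      split_ifs with hj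
      · rfl
      · refine congrArg some (C.compute_congr {v | ∃ i ∈ I, C.inNode i = v} ?_ ?_ j ?_)
        · intro i hi
          exact hx i fun h => hi ⟨i, h, rfl⟩
        · rintro e ⟨i, hi, hie⟩ hd
          have h3 := (Finset.mem_filter.1 (Finset.mem_filter.1 hi).1).2 e hie.symm
          exact absurd ⟨i, hi, hie.trans h3.symm⟩ hd
        · rintro ⟨i, hi, hij⟩
          exact (Finset.mem_filter.1 hi).2 j hj hij.symm)
    rw [Fintype.card_unit, mul_one] at h2
    have h3 : (decodedCorrectly C.compute dec E).card * 2 ^ C.silent.card ≤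
        2 ^ (O \ E).card * 2 ^ k := by
      calc _ ≤ (decodedCorrectly C.compute dec E).card * 2 ^ (I.card + (O \ E).card) :=
            Nat.mul_le_mul_left _ (Nat.pow_le_pow_right (by norm_num) hI)
        _ = (decodedCorrectly C.compute dec E).card * 2 ^ I.card * 2 ^ (O \ E).card := by
          rw [pow_add, mul_assoc]
        _ ≤ 2 ^ k * 2 ^ (O \ E).card := Nat.mul_le_mul_right _ h2
        _ = _ := mul_comm _ _
    rw [div_pow, one_pow, mul_one_div, div_le_div_iff₀ (by positivity) (by positivity)]
    exact_mod_cast h3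
  rw [blockErrorProb_eq]
  simp_rw [mul_one_sub]
  rw [Finset.sum_sub_distrib, sum_erasure, sub_sub_cancel]
  -- Averaging `2 ^ (O \ E).card` is the generating function at `u = 2`: each silent input
  -- contributes a factor `(2 - ε) / 2`.
  calc _ ≤ ∑ E : Finset (Fin n), ε ^ E.card * (1 - ε) ^ (n - E.card) *
        (2 ^ (O \ E).card * (1 / 2) ^ C.silent.card) :=
        Finset.sum_le_sum fun E _ =>
          mul_le_mul_of_nonneg_left (hE E) (erasure_weight_nonneg h0 h1 _ _)
    _ = (ε + 2 * (1 - ε)) ^ O.card * (1 / 2) ^ C.silent.card := by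
      rw [← sum_erasure_mul_pow, Finset.sum_mul]
      simp_rw [mul_assoc]
    _ ≤ (ε + 2 * (1 - ε)) ^ C.silent.card * (1 / 2) ^ C.silent.card := by
      gcongr
      linarith
    _ = _ := by
      rw [← mul_pow]
      congr 1
      ring

/-- For large `L` the cubes give the bound. For bounded `L`, energy need not exceed `n`, since an
input node may serve as an output node; there the at least `R / 4 * n` non-silent inputs provide a
linear bound. -/
theorem exists_le_bitMeters {ε : ℝ} (h0 : 0 < ε) (h1 : ε < 1) {R : ℝ} (hR : 0 < R) :
    ∃ c : ℝ, 0 < c ∧ ∀ {k n : ℕ} (C : BitMetersCircuit k n)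
      (dec : (Fin n → Option Bool) → (Fin k → Bool)),
      R / 2 * n ≤ k → blockErrorProb ε C.compute dec ≤ 1 → C.silent.card ≤ R / 4 * n →
      c * (n * (-Real.log (blockErrorProb ε C.compute dec)) ^ (1 / 3 : ℝ)) ≤ C.bitMeters := by
  obtain ⟨κ, hκ, L₀, hL₀, h⟩ := exists_number_of_erasures_pow h0 h1 3 (by norm_num)
  set c := min (R / 4 / L₀ ^ (1 / 3 : ℝ)) (κ * R / 6) with hc
  refine ⟨c, by positivity, ?_⟩
  intro k n C dec hk hPe1 hs
  have hPe0 := blockErrorProb_nonneg h0.le h1.le C.compute dec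
  set P := blockErrorProb ε C.compute dec with hP
  have hL : 0 ≤ -Real.log P := neg_nonneg.2 (Real.log_nonpos hPe0 hPe1)
  set L := -Real.log P with hLdef
  rcases le_or_gt L L₀ with hLL | hLL
  · have h2 := C.le_card_silent_add_bitMeters
    have h3 : c * L ^ (1 / 3 : ℝ) ≤ R / 4 := by
      calc c * L ^ (1 / 3 : ℝ) ≤ R / 4 / L₀ ^ (1 / 3 : ℝ) * L₀ ^ (1 / 3 : ℝ) := by
            gcongr
            exact min_le_left _ _
        _ = _ := by field_simp
    calc c * (n * L ^ (1 / 3 : ℝ)) = c * L ^ (1 / 3 : ℝ) * n := by ring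
      _ ≤ R / 4 * n := by gcongr
      _ ≤ _ := by linarith
  · obtain ⟨q, hq, hqL, hqe⟩ := h L hLL.le
    norm_num only [Nat.cast_ofNat] at hqL
    -- Vanishing error probability belongs to the other case, because `Real.log 0 = 0` gives `L =
    -- 0`.
    have hP0 : 0 < P := by
      refine lt_of_le_of_ne hPe0 fun h => ?_
      rw [hLdef, ← h] at hLL
      simp only [Real.log_zero, neg_zero] at hLL
      linarith
    rw [hLdef, neg_neg, Real.exp_log hP0] at hqe
    have h2 := C.side_mul_le_bitMeters h0.le h1.le q hq hqe
    calc c * (n * L ^ (1 / 3 : ℝ)) ≤ κ * R / 6 * (n * L ^ (1 / 3 : ℝ)) :=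
          mul_le_mul_of_nonneg_right (min_le_right _ _) (by positivity)
      _ = (κ * L ^ (1 / 3 : ℝ)) * (R / 2 * n) / 3 := by ring
      _ ≤ q * k / 3 := by gcongr
      _ ≤ _ := by linarith

end BitMetersCircuit

/-! ## The main theorem -/

lemma eventually_half_rate_le {n k : ℕ → ℕ} (hn : StrictMono n) {R : ℝ} (hR : 0 < R)
    (h : Tendsto (fun i => (k i : ℝ) / n i) atTop (𝓝 R)) :
    ∀ᶠ i in atTop, 0 < n i ∧ R / 2 * n i ≤ k i := by
  filter_upwards [hn.tendsto_atTop.eventually_gt_atTop 0,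
    h.eventually_const_le (half_lt_self hR)] with i h0 h1
  rw [le_div_iff₀ (by exact_mod_cast h0)] at h1
  exact ⟨h0, h1⟩

/-- What holds for every single code of error probability less than `f ≤ 1` and rate at least
`R / 2` holds eventually for every scheme. -/
lemma EncodingScheme.eventually_of_code {m : ℕ} (S : EncodingScheme m) {ε R : ℝ} (hR : 0 < R)
    {f : ℕ → ℝ} (hf : ∀ᶠ N in atTop, f N ≤ 1) (hS : S.IsEncodingSchemeFor ε f)
    (hRate : S.HasRate R) {p : ℕ → Prop}
    (h : ∀ i, 0 < S.n i → R / 2 * S.n i ≤ S.k i →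
      blockErrorProb ε (S.encoder i).compute (S.decoder i) < f (S.n i) → f (S.n i) ≤ 1 → p i) :
    ∀ᶠ i in atTop, p i := by
  filter_upwards [eventually_half_rate_le S.n_strictMono hR hRate,
    S.n_strictMono.tendsto_atTop.eventually hf, hS] with i h1 h2 h3
  exact h i h1.1 h1.2 h3 h2

theorem mainTheorem8 (ε : ℝ) (hε₀ : 0 < ε) (hε₁ : ε < 1) (R : ℝ) (hR : 0 < R) :
    -- fully-parallel schemes: the bound in terms of the number of clock cycles
    (∃ c : ℝ, 0 < c ∧ ∀ (m : ℕ) (f : ℕ → ℝ) (S : EncodingScheme m),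
      (∀ᶠ N in atTop, f N ≤ 1) → S.IsEncodingSchemeFor ε f → S.HasRate R → S.FullyParallel →
        ∀ᶠ i in atTop, c * (S.n i * (-Real.log (f (S.n i))) / S.T i) ≤ S.E i) ∧
    -- fully-parallel schemes: the universal bound
    (∃ c : ℝ, 0 < c ∧ ∀ (m : ℕ) (f : ℕ → ℝ) (S : EncodingScheme m),
      (∀ᶠ N in atTop, f N ≤ 1) → S.IsEncodingSchemeFor ε f → S.HasRate R → S.FullyParallel →
        ∀ᶠ i in atTop, c * (S.n i * Real.sqrt (-Real.log (f (S.n i)))) ≤ S.E i) ∧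
    -- fully-parallel schemes: the number of clock cycles when the universal bound is met
    (∀ K : ℝ, ∃ c : ℝ, 0 < c ∧ ∀ (m : ℕ) (f : ℕ → ℝ) (S : EncodingScheme m),
      (∀ᶠ N in atTop, f N ≤ 1) → S.IsEncodingSchemeFor ε f → S.HasRate R → S.FullyParallel →
        (∀ᶠ i in atTop, S.E i ≤ K * (S.n i * Real.sqrt (-Real.log (f (S.n i))))) →
          ∀ᶠ i in atTop, c * Real.sqrt (-Real.log (f (S.n i))) ≤ S.T i) ∧
    -- serial schemes
    (∀ m j : ℕ, ∃ c : ℝ, 0 < c ∧ ∀ (f : ℕ → ℝ) (S : EncodingScheme m),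
      (∀ᶠ N in atTop, f N ≤ 1) → S.IsEncodingSchemeFor ε f → S.HasRate R → S.Serial j →
        ∀ᶠ i in atTop, c * (S.n i * (-Real.log (f (S.n i)))) ≤ S.E i) ∧
    -- output-regular schemes, however the number of output nodes grows with the block length
    (∀ m : ℕ, ∃ c : ℝ, 0 < c ∧ ∀ (f : ℕ → ℝ) (S : EncodingScheme m),
      (∀ᶠ N in atTop, f N ≤ 1) → S.IsEncodingSchemeFor ε f → S.HasRate R → S.OutputRegular →
        ∀ᶠ i in atTop, c * (S.n i * (-Real.log (f (S.n i))) ^ (1 / 5 : ℝ)) ≤ S.E i) ∧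
    -- three-dimensional bit-meters schemes
    (∀ δ : ℝ, δ < 1 → ∃ c : ℝ, 0 < c ∧ ∀ S : BitMetersEncodingScheme,
      S.HasRate R → (∀ᶠ i in atTop, S.Pe ε i ≤ δ) →
        ∀ᶠ i in atTop, c * (S.n i * (-Real.log (S.Pe ε i)) ^ (1 / 3 : ℝ)) ≤ S.E i) := by

  obtain ⟨c, hc, hpar⟩ := Circuit.FullyParallel.exists_le_energy_mul hε₀ hε₁ hR
  refine ⟨⟨c, hc, ?_⟩, ⟨Real.sqrt c, Real.sqrt_pos.2 hc, ?_⟩, ?_, ?_, ?_, ?_⟩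
  · intro m f S hf hS hRate hFP
    refine S.eventually_of_code hR hf hS hRate fun i hn hk hPe hf1 => ?_
    have h := hpar (S.encoder i) (S.decoder i) _ (hFP i) hn hk hPe hf1
    have hT : (0 : ℝ) < S.T i := Nat.cast_pos.2 ((S.encoder i).one_le_T hn)
    rw [mul_div_assoc', div_le_iff₀ hT]
    exact h
  · intro m f S hf hS hRate hFP
    refine S.eventually_of_code hR hf hS hRate fun i hn hk hPe hf1 => ?_
    have h := hpar (S.encoder i) (S.decoder i) _ (hFP i) hn hk hPe hf1
    have hL := Circuit.neg_log_nonneg hε₀.le hε₁.le hPe hf1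
    have hA : (S.n i : ℝ) ≤ (S.encoder i).area := by
      have := (S.encoder i).card_outputNodes_le
      rw [(hFP i).card_outputNodes] at this
      exact_mod_cast this
    -- Compare squares: `E ^ 2 = (E * T) * A`, where `E * T ≥ c * n * L` and `A ≥ n`.
    refine abs_le_of_sq_le_sq' ?_ (Nat.cast_nonneg _) |>.2
    rw [mul_pow, mul_pow, Real.sq_sqrt hc.le, Real.sq_sqrt hL]
    calc c * ((S.n i : ℝ) ^ 2 * -Real.log (f (S.n i)))
        = c * (S.n i * -Real.log (f (S.n i))) * S.n i := by ring
      _ ≤ (S.encoder i).energy * (S.encoder i).T * (S.encoder i).area := by gcongr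
      _ = S.E i ^ 2 := by
        rw [EncodingScheme.E, Circuit.energy, Nat.cast_mul]
        ring
  · intro K
    -- From `c * n * L ≤ E * T ≤ K * n * √L * T` one cancels `n * √L`; the maximum with 1 makes the
    -- constant positive whatever the sign of `K`.
    refine ⟨c / max K 1, by positivity, ?_⟩
    intro m f S hf hS hRate hFP hK
    refine (hK.and (S.eventually_of_code hR hf hS hRate
      (p := fun i => S.E i ≤ K * (S.n i * Real.sqrt (-Real.log (f (S.n i)))) →
        c / max K 1 * Real.sqrt (-Real.log (f (S.n i))) ≤ S.T i)
      fun i hn hk hPe hf1 hE => ?_)).mono fun i hi => hi.2 hi.1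
    have h := hpar (S.encoder i) (S.decoder i) _ (hFP i) hn hk hPe hf1
    have hL := Circuit.neg_log_nonneg hε₀.le hε₁.le hPe hf1
    have hn' : (0 : ℝ) < S.n i := by exact_mod_cast hn
    have hM : 0 < max K 1 := by positivity
    have hT : (0 : ℝ) ≤ S.T i := Nat.cast_nonneg _
    rcases hL.eq_or_lt with h0 | h0
    · rw [← h0, Real.sqrt_zero, mul_zero]
      exact hT
    · have hs := Real.sqrt_pos.2 h0
      set s := Real.sqrt (-Real.log (f (S.n i)))
      have h2 : c * (S.n i * (s * s)) ≤ max K 1 * (S.n i * s) * S.T i := by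
        rw [Real.mul_self_sqrt hL]
        refine h.trans (mul_le_mul_of_nonneg_right (hE.trans ?_) hT)
        exact mul_le_mul_of_nonneg_right (le_max_left _ _) (by positivity)
      rw [div_mul_eq_mul_div, div_le_iff₀ hM]
      refine le_of_mul_le_mul_right ?_ (mul_pos hn' hs)
      linarith
  · intro m j
    obtain ⟨c, hc, h⟩ := Circuit.exists_le_energy_of_serial hε₀ hε₁ hR m j
    refine ⟨c, hc, fun f S hf hS hRate hj => ?_⟩
    exact S.eventually_of_code hR hf hS hRate fun i hn hk hPe hf1 =>
      h (S.encoder i) (S.decoder i) _ (hj i) hn hk hPe hf1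
  · intro m
    obtain ⟨c, hc, h⟩ := Circuit.exists_le_energy hε₀ hε₁ hR m
    refine ⟨c, hc, fun f S hf hS hRate _ => ?_⟩
    exact S.eventually_of_code hR hf hS hRate fun i _ hk hPe hf1 =>
      h (S.encoder i) (S.decoder i) _ hk hPe hf1
  · intro δ hδ
    obtain ⟨c, hc, h⟩ := BitMetersCircuit.exists_le_bitMeters hε₀ hε₁ hR
    refine ⟨c, hc, fun S hRate hPe => ?_⟩
    -- More than `s` silent inputs would push the success probability below `1 - δ`. Since `s` is
    -- fixed, `R / 4 * n` eventually exceeds it; `δ` affects only how large `n` has to be.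
    obtain ⟨s, hs⟩ := exists_pow_lt_of_lt_one (sub_pos.2 hδ) (by linarith : 1 - ε / 2 < 1)
    have hlarge : ∀ᶠ i in atTop, (s : ℝ) ≤ R / 4 * S.n i :=
      ((tendsto_natCast_atTop_atTop.comp S.n_strictMono.tendsto_atTop).const_mul_atTop
        (by positivity)).eventually_ge_atTop _
    filter_upwards [eventually_half_rate_le S.n_strictMono hR hRate, hPe, hlarge] with i h1 h2 h3
    refine h (S.encoder i) (S.decoder i) h1.2 (h2.trans hδ.le) (le_trans ?_ h3)
    have h4 := (S.encoder i).one_sub_blockErrorProb_le hε₀.le hε₁.le (S.decoder i)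
    by_contra! hlt
    have h5 : (1 - ε / 2) ^ (S.encoder i).silent.card ≤ (1 - ε / 2) ^ s :=
      pow_le_pow_of_le_one (by linarith) (by linarith) (by exact_mod_cast hlt.le)
    change blockErrorProb ε (S.encoder i).compute (S.decoder i) ≤ δ at h2
    linarith
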